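/- Let $\mathbb K$ be a field of characteristic $0$, $\mathfrak g$ a Lie algebra over $\mathbb K$ (of any dimension) and $P:\mathfrak g\to\mathfrak g$ an idempotent linear map; put $\tilde P=\mathrm{id}-P$, $\mathfrak g^-=P(\mathfrak g)$, $\mathfrak g^+=\tilde P(\mathfrak g)$, so $\mathfrak g=\mathfrak g^-\oplus\mathfrak g^+$ as vector spaces. Let $\bar{\mathfrak g}=\mathfrak g[[s,t]]$ with the bracket extended to series and the filtration $(\bar{\mathfrak g}_n)_n$ by total degree in $s,t$, so that $\bar{\mathfrak g}_1=s\bar{\mathfrak g}+t\bar{\mathfrak g}$; extend $P,\tilde P$ coefficientwise to $\bar{\mathfrak g}$. Limits are taken in the topology given by the filtration, and exponentials of elements of $\bar{\mathfrak g}_1$ are taken in $U(\mathfrak g)[[s,t]]$, where $U(\mathfrak g)$ is the universal enveloping algebra. Let $C(x,y)=x+y+\mathrm{BCH}(x,y)=\log(\exp(x)\exp(y))$ be the Baker–Campbell–Hausdorff Lie series. For $R\in\{P,\tilde P\}$ and $a\in\bar{\mathfrak g}_1$ let $\chi_R(a)=\lim_n\chi_{R,(n)}(a)$, where $\chi_{R,(0)}(a)=a$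 and $$\chi_{R,(n+1)}(a)=a-\mathrm{BCH}\big(R(\chi_{R,(n)}(a)),(\mathrm{id}-R)(\chi_{R,(n)}(a))\big);$$ write $\chi=\chi_P$, $\tilde\chi=\chi_{\tilde P}$ and $D_P(a)=(P(\chi(a)),\tilde P(\chi(a)))$. Let $A_-=P(\bar{\mathfrak g}_1)$, $A_+=\tilde P(\bar{\mathfrak g}_1)$, $U_-=s\,\mathfrak g^-[[s,t]]$, $U_+=t\,\mathfrak g^+[[s,t]]$. Then for $x,y\in\bar{\mathfrak g}_1$ the series $C(x,y)$ converges to an element of $\bar{\mathfrak g}_1$ with $\exp(C(x,y))=\exp(x)\exp(y)$; the recursions defining $\chi$ and $\tilde\chi$ converge on $\bar{\mathfrak g}_1$ and define bijections $\bar{\mathfrak g}_1\to\bar{\mathfrak g}_1$; $U_-\subseteq A_-$, $U_+\subseteq A_+$, the sum $V=U_-+U_+$ is direct and is contained in $\bar{\mathfrak g}_1$. Moreover: 1. (Factorization.) $C$ restricts to a bijection $C_-:A_-\times A_+\to\bar{\mathfrak g}_1$, and $C_-$ restricts to a bijection $C: U_-\times U_+\to V=U_-\oplus U_+$ (the Barron–Huang–Lepowsky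 factorization). 2. (Uniformization.) There is a unique bijection $\Psi:A_+\times A_-\to A_-\times A_+$ such that $\exp(a_+)\exp(a_-)=\exp(\pi_-\Psi(a))\exp(\pi_+\Psi(a))$ for all $a=(a_+,a_-)\in A_+\times A_-$, where $\pi_\mp$ denote the two projections of $A_-\times A_+$. There is a unique bijection $\Psi_0:U_+\times U_-\to U_-\times U_+$ such that $\exp(a_+)\exp(a_-)=\exp(\pi_-\Psi_0(a))\exp(\pi_+\Psi_0(a))$ for all $a=(a_+,a_-)\in U_+\times U_-$ (the Barron–Huang–Lepowsky uniformization), and $\Psi_0$ is the restriction of $\Psi$ to $U_+\times U_-$. 3. (Formulas.) The inverse of $C_-$ is $D_P:\bar{\mathfrak g}_1\to A_-\times A_+$, and $D_P$ restricts to the inverse $V\to U_-\times U_+$ of $C:U_-\times U_+\to V$. For $a=(a_+,a_-)\in A_+\times A_-$, $$\Psi(a)=\big(P(\chi(C(a_+,a_-))),\tilde P(\chi(C(a_+,a_-)))\big)=\big(P(\chi(\tilde\chi^{-1}(a_++a_-))),\tilde P(\chi(\tilde\chi^{-1}(a_++a_-)))\big).$$ The maps $\chi$ and $\tilde\chi$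 restrict to bijections $V\to V$, and the same two formulas, with $\chi$ and $\tilde\chi^{-1}$ restricted to $V$, give $\Psi_0(a)$ for $a\in U_+\times U_-$. -/

import Mathlib

open Finset

namespace BHL

/-! ### Exponential and logarithm of formal power series -/

section ExpLog

variable (K : Type*) [Field K] {σ A : Type*} [Ring A] [Algebra K A]

/-- `exp f = ∑ k, f ^ k / k!` for a power series `f` (with coefficients in an associative, possibly
noncommutative algebra `A`) with zero constant term.  As `f ^ k` starts in total degree `k`, only
`k ≤ |d|` contribute to the coefficient of index `d`. -/
noncomputable def formalExp (f : MvPowerSeries σ A) : MvPowerSeries σ A := fun d =>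
  ∑ k ∈ range (d.degree + 1), ((k.factorial : K)⁻¹) • MvPowerSeries.coeff d (f ^ k)

/-- `log f = ∑ k ≥ 1, (-1) ^ (k + 1) (f - 1) ^ k / k` for a power series `f` with constant term `1`.
As `(f - 1) ^ k` starts in total degree `k`, only `k ≤ |d|` contribute to the coefficient of
index `d`. -/
noncomputable def formalLog (f : MvPowerSeries σ A) : MvPowerSeries σ A := fun d =>
  ∑ k ∈ Icc 1 d.degree, ((-1 : K) ^ (k + 1) / (k : K)) • MvPowerSeries.coeff d ((f - 1) ^ k)

end ExpLog

/-! ### The Baker--Campbell--Hausdorff series as a Lie series -/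

section BCHSeries

variable (K : Type*) [Field K]

-- associative algebras are Lie algebras under the commutator
attribute [local instance] LieRing.ofAssociativeRing

/-- The homogeneous component of degree `n` of `log (exp x * exp y)` in the noncommutative power
series in `x = ι 0` and `y = ι 1`: the coefficient of `T ^ n` in `log (exp (x T) * exp (y T))`. -/
noncomputable def hausdorffAssoc (n : ℕ) : FreeAlgebra K (Fin 2) :=
  PowerSeries.coeff n
    (formalLog K
      (formalExp K (PowerSeries.monomial 1 (FreeAlgebra.ι K (0 : Fin 2))) *
        formalExp K (PowerSeries.monomial 1 (FreeAlgebra.ι K (1 : Fin 2)))) :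
      PowerSeries (FreeAlgebra K (Fin 2)))

/-- The canonical embedding of the free Lie algebra into the free associative algebra. -/
noncomputable def freeLieToAssoc : FreeLieAlgebra K (Fin 2) →ₗ⁅K⁆ FreeAlgebra K (Fin 2) :=
  FreeLieAlgebra.lift K (FreeAlgebra.ι K)

open Classical in
/-- `log (exp x * exp y)` is a Lie series: its component of degree `n` is (the image of) a unique
Lie polynomial, which is `hausdorffLie K n`. -/
noncomputable def hausdorffLie (n : ℕ) : FreeLieAlgebra K (Fin 2) :=
  if h : ∃ p, freeLieToAssoc K p = hausdorffAssoc K n then h.choose else 0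

end BCHSeries

/-! ### Filtered Lie algebras: BCH, the recursion map `χ` and the map `D_P` -/

section Filtered

variable {K : Type*} [Field K] {L : Type*} [LieRing L] [LieAlgebra K L]

/-- `u n` tends to `l` in the topology given by the filtration `F`. -/
def IsFiltLim (F : ℕ → Submodule K L) (u : ℕ → L) (l : L) : Prop :=
  ∀ N, ∃ M, ∀ n, M ≤ n → u n - l ∈ F N

open Classical in
/-- The limit of a sequence in the topology given by the filtration `F` (`0` if there is none). -/
noncomputable def filtLim (F : ℕ → Submodule K L) (u : ℕ → L) : L :=
  if h : ∃ l, IsFiltLim F u l then h.choose else 0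

/-- The partial sums of the series `C(x, y) = log (exp x * exp y)`, evaluated in `L`. -/
noncomputable def hausdorffSum (K : Type*) [Field K] {L : Type*} [LieRing L] [LieAlgebra K L]
    (x y : L) (n : ℕ) : L :=
  ∑ k ∈ range n, FreeLieAlgebra.lift K ![x, y] (hausdorffLie K k)

/-- `C(x, y)`, the sum of the Lie series `log (exp x * exp y)`. -/
noncomputable def C (F : ℕ → Submodule K L) (x y : L) : L := filtLim F (hausdorffSum K x y)

/-- `BCH(x, y)`, defined by `C(x, y) = x + y + BCH(x, y)`. -/
noncomputable def BCH (F : ℕ → Submodule K L) (x y : L) : L := C F x y - x - y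

/-- `P̃ = id - P`. -/
def compl (P : L →ₗ[K] L) : L →ₗ[K] L := LinearMap.id - P

/-- The BCH-recursion `χ₀(a) = a`, `χₙ₊₁(a) = a - BCH(P(χₙ(a)), P̃(χₙ(a)))`. -/
noncomputable def chiSeq (F : ℕ → Submodule K L) (P : L →ₗ[K] L) (a : L) : ℕ → L
  | 0 => a
  | n + 1 => a - BCH F (P (chiSeq F P a n)) (compl P (chiSeq F P a n))

/-- `χ(a)`, the limit of the BCH-recursion associated with `P`. -/
noncomputable def chi (F : ℕ → Submodule K L) (P : L →ₗ[K] L) (a : L) : L :=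
  filtLim F (chiSeq F P a)

/-- `D_P(a) = (P(χ(a)), P̃(χ(a)))`. -/
noncomputable def D (F : ℕ → Submodule K L) (P : L →ₗ[K] L) (a : L) : L × L :=
  (P (chi F P a), compl P (chi F P a))

end Filtered

/-! ### The Lie algebra `g[[s,t]]` -/

/-- `g[[s,t]]`: formal power series in the commuting variables `s` (index `0`) and `t` (index `1`)
with coefficients in `g`. -/
def LieSeries (g : Type*) : Type _ := (Fin 2 →₀ ℕ) → g

namespace LieSeries

section

variable {g : Type*} [LieRing g]

instance : AddCommGroup (LieSeries g) := inferInstanceAs (AddCommGroup ((Fin 2 →₀ ℕ) → g))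

instance {K : Type*} [Field K] [LieAlgebra K g] : Module K (LieSeries g) :=
  inferInstanceAs (Module K ((Fin 2 →₀ ℕ) → g))

/-- `[∑ x_d s^i t^j, ∑ y_e s^k t^l] = ∑ [x_d, y_e] s^(i+k) t^(j+l)`. -/
noncomputable instance : Bracket (LieSeries g) (LieSeries g) where
  bracket x y := fun d => ∑ p ∈ antidiagonal d, ⁅x p.1, y p.2⁆

theorem add_apply (x y : LieSeries g) (d : Fin 2 →₀ ℕ) : (x + y) d = x d + y d := rfl

theorem smul_apply {K : Type*} [Field K] [LieAlgebra K g] (c : K) (x : LieSeries g)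
    (d : Fin 2 →₀ ℕ) : (c • x) d = c • x d := rfl

theorem bracket_apply (x y : LieSeries g) (d : Fin 2 →₀ ℕ) :
    ⁅x, y⁆ d = ∑ p ∈ antidiagonal d, ⁅x p.1, y p.2⁆ := rfl

theorem sum_assoc (f : (Fin 2 →₀ ℕ) → (Fin 2 →₀ ℕ) → (Fin 2 →₀ ℕ) → g) (d : Fin 2 →₀ ℕ) :
    ∑ p ∈ antidiagonal d, ∑ q ∈ antidiagonal p.1, f q.1 q.2 p.2 =
      ∑ p ∈ antidiagonal d, ∑ q ∈ antidiagonal p.2, f p.1 q.1 q.2 := by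
  simp only [Finset.sum_sigma']
  apply Finset.sum_nbij' (fun ⟨⟨_i, j⟩, ⟨k, l⟩⟩ ↦ ⟨(k, l + j), (l, j)⟩)
    (fun ⟨⟨i, _j⟩, ⟨k, l⟩⟩ ↦ ⟨(i + k, l), (i, k)⟩) <;>
    rintro ⟨⟨a, b⟩, ⟨e, f⟩⟩ h <;>
    simp only [Finset.mem_sigma, Finset.HasAntidiagonal.mem_antidiagonal] at h <;>
    obtain ⟨h1, rfl⟩ := h <;>
    simp_all [add_assoc]

theorem sum_swap (f : (Fin 2 →₀ ℕ) → (Fin 2 →₀ ℕ) → g) (d : Fin 2 →₀ ℕ) :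
    ∑ p ∈ antidiagonal d, f p.1 p.2 = ∑ p ∈ antidiagonal d, f p.2 p.1 := by
  apply Finset.sum_nbij' (fun p ↦ p.swap) (fun p ↦ p.swap) <;>
    simp +contextual [add_comm]

noncomputable instance : LieRing (LieSeries g) where
  add_lie x y z := by
    funext d
    simp [bracket_apply, add_apply, Finset.sum_add_distrib]
  lie_add x y z := by
    funext d
    simp [bracket_apply, add_apply, Finset.sum_add_distrib]
  lie_self x := by
    funext d
    rw [bracket_apply]
    refine Finset.sum_involution (fun p _ => p.swap) ?_ ?_ ?_ ?_
    · intro p _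
      simp only [Prod.fst_swap, Prod.snd_swap]
      rw [← lie_skew, neg_add_cancel]
    · rintro ⟨p, q⟩ _ h1 h2
      apply h1
      have : q = p := congrArg Prod.fst h2
      simp [this]
    · rintro p hp
      simpa [add_comm] using hp
    · intro p _
      rfl
  leibniz_lie x y z := by
    funext d
    simp only [add_apply, bracket_apply, lie_sum, sum_lie]
    have h1 := sum_assoc (fun a b c => ⁅⁅x a, y b⁆, z c⁆) d
    have h2 : ∑ p ∈ antidiagonal d, ∑ q ∈ antidiagonal p.2, ⁅y p.1, ⁅x q.1, z q.2⁆⁆ =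
        ∑ p ∈ antidiagonal d, ∑ q ∈ antidiagonal p.2, ⁅y q.1, ⁅x p.1, z q.2⁆⁆ := by
      rw [← sum_assoc (fun a b c => ⁅y a, ⁅x b, z c⁆⁆) d,
        ← sum_assoc (fun a b c => ⁅y b, ⁅x a, z c⁆⁆) d]
      exact Finset.sum_congr rfl fun p _ => sum_swap (fun a b => ⁅y a, ⁅x b, z p.2⁆⁆) p.1
    rw [h1, h2, ← Finset.sum_add_distrib]
    refine Finset.sum_congr rfl fun p _ => ?_
    rw [← Finset.sum_add_distrib]
    exact Finset.sum_congr rfl fun q _ => leibniz_lie _ _ _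

noncomputable instance {K : Type*} [Field K] [LieAlgebra K g] : LieAlgebra K (LieSeries g) where
  lie_smul c x y := by
    funext d
    simp [bracket_apply, smul_apply, Finset.smul_sum]

end

section

variable (K : Type*) [Field K] {g : Type*} [LieRing g] [LieAlgebra K g]

/-- The filtration of `g[[s,t]]` by the total degree in `s` and `t`. -/
def filtration (n : ℕ) : Submodule K (LieSeries g) where
  carrier := {x | ∀ d : Fin 2 →₀ ℕ, d.degree < n → x d = 0}
  add_mem' {x y} hx hy d hd := by rw [add_apply, hx d hd, hy d hd, add_zero]
  zero_mem' _ _ := rfl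
  smul_mem' c x hx d hd := by rw [smul_apply, hx d hd, smul_zero]

/-- Multiplication by the variable `s` (`i = 0`) or `t` (`i = 1`). -/
noncomputable def mulVar (i : Fin 2) : LieSeries g →ₗ[K] LieSeries g where
  toFun x := fun d => if 1 ≤ d i then x (d - Finsupp.single i 1) else 0
  map_add' x y := by
    funext d
    change (if 1 ≤ d i then x (d - Finsupp.single i 1) + y (d - Finsupp.single i 1) else 0) =
      (if 1 ≤ d i then x (d - Finsupp.single i 1) else 0) +
        (if 1 ≤ d i then y (d - Finsupp.single i 1) else 0)
    by_cases h : 1 ≤ d i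
    · rw [if_pos h, if_pos h, if_pos h]
    · rw [if_neg h, if_neg h, if_neg h, add_zero]
  map_smul' c x := by
    funext d
    change (if 1 ≤ d i then c • x (d - Finsupp.single i 1) else 0) =
      c • (if 1 ≤ d i then x (d - Finsupp.single i 1) else 0)
    by_cases h : 1 ≤ d i
    · rw [if_pos h, if_pos h]
    · rw [if_neg h, if_neg h, smul_zero]

variable {K}

/-- The coefficientwise extension of a linear map `P` of `g` to `g[[s,t]]`. -/
def mapCoeff (P : g →ₗ[K] g) : LieSeries g →ₗ[K] LieSeries g where
  toFun x := fun d => P (x d)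
  map_add' x y := by
    funext d
    exact P.map_add (x d) (y d)
  map_smul' c x := by
    funext d
    exact P.map_smul c (x d)

/-- For a linear subspace `W` of `g`, the series `W[[s,t]]` with all coefficients in `W`. -/
def coeffsIn (W : Submodule K g) : Submodule K (LieSeries g) where
  carrier := {x | ∀ d, x d ∈ W}
  add_mem' hx hy d := W.add_mem (hx d) (hy d)
  zero_mem' _ := W.zero_mem
  smul_mem' c _ hx d := W.smul_mem c (hx d)

/-- `s g⁻[[s,t]]`, where `g⁻ = P(g)`. -/
noncomputable def sMinus (P : g →ₗ[K] g) : Submodule K (LieSeries g) :=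
  (coeffsIn (LinearMap.range P)).map (mulVar K 0)

/-- `t g⁺[[s,t]]`, where `g⁺ = P̃(g)`. -/
noncomputable def tPlus (P : g →ₗ[K] g) : Submodule K (LieSeries g) :=
  (coeffsIn (LinearMap.range (compl P))).map (mulVar K 1)

variable (K)

/-- The exponential `exp(x)` of `x ∈ g[[s,t]]` (with zero constant term) in `U(g)[[s,t]]`, where
`U(g)` is the universal enveloping algebra of `g`. -/
noncomputable def exp (x : LieSeries g) :
    MvPowerSeries (Fin 2) (UniversalEnvelopingAlgebra K g) :=
  formalExp K (fun d => UniversalEnvelopingAlgebra.ι K (x d) :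
    MvPowerSeries (Fin 2) (UniversalEnvelopingAlgebra K g))

/-- `Ψ` is a bijection `Sp × Sm → Sm × Sp` with
`exp(a₊) exp(a₋) = exp(π₋(Ψ(a))) exp(π₊(Ψ(a)))` for all `a = (a₊, a₋) ∈ Sp × Sm`. -/
def IsUniformization (Sp Sm : Submodule K (LieSeries g))
    (Ψ : LieSeries g × LieSeries g → LieSeries g × LieSeries g) : Prop :=
  Set.BijOn Ψ ((Sp : Set (LieSeries g)) ×ˢ (Sm : Set (LieSeries g)))
      ((Sm : Set (LieSeries g)) ×ˢ (Sp : Set (LieSeries g))) ∧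
    ∀ a ∈ (Sp : Set (LieSeries g)) ×ˢ (Sm : Set (LieSeries g)),
      exp K a.1 * exp K a.2 = exp K (Ψ a).1 * exp K (Ψ a).2

/-- `Ψ` is the unique uniformization bijection `Sp × Sm → Sm × Sp` (as a map on `Sp × Sm`). -/
def IsUniqueUniformization (Sp Sm : Submodule K (LieSeries g))
    (Ψ : LieSeries g × LieSeries g → LieSeries g × LieSeries g) : Prop :=
  IsUniformization K Sp Sm Ψ ∧
    ∀ Φ, IsUniformization K Sp Sm Φ →
      Set.EqOn Φ Ψ ((Sp : Set (LieSeries g)) ×ˢ (Sm : Set (LieSeries g)))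

end

end LieSeries

end BHL

/-! The map `χ_P` is the inverse of `c ↦ C(P c, P̃ c)` on series without constant term. If two
arguments agree below degree `n`, their values of `BCH` agree below degree `n + 1`
(`hausdorff_sub_mem`), so `c ↦ a - BCH(P c, P̃ c)` is a contraction for the filtration. Its iterates
converge to a solution of `C(P c, P̃ c) = a` (`exists_chiSeq_limit`), and the same estimate makes
the solution unique (`splitC_injOn`). Hence `D_P` inverts `C` on `A₋ × A₊`. With `P` and `P̃`
exchanged, `χ̃⁻¹(a₊ + a₋) = C(a₊, a₋)`, and `Ψ = D_P ∘ C`. It is the only possible map, since both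
`exp` and `C` on `A₋ × A₊` are injective.

The restriction to `V = U₋ ⊕ U₊` needs one more fact: for `u ∈ U₋` and `w ∈ U₊`, setting `s = 0`
kills `u` and setting `t = 0` kills `w`. In both cases `BCH(u, w)` becomes zero, so it is divisible
by `s` and by `t` and lies in `V` (`BCH_mem_of_sMinus_tPlus`). As `V` is closed, the recursion and
its limit stay in `V`. The structure `IsSplitting` records what both situations share, so each
argument is made once.

The estimates are proved for `log(exp x exp y)` in the associative algebra `U(g)[[s,t]]` and pulled
back to `g[[s,t]]`. This rests on two classical theorems. The embedding `g → U(g)` is injective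
(`universalEnveloping_ι_injective`), proved by letting `g` act on polynomials in an ordered basis as
in the Poincaré–Birkhoff–Witt theorem. The components of `log(exp x exp y)` are Lie polynomials
(`psCoeff_hausdorff_mem`): applying the Euler derivation to `exp z = exp x exp y` gives an equation
whose degree `n` part is `n z_n` plus commutators of lower components, so induction works in
characteristic `0`. -/

namespace BHL

noncomputable section

/-! ### Locally finite sums of formal power series -/

section LocallyFinite

variable (K : Type*) [Field K] {σ A : Type*} [Ring A] [Algebra K A]

/-- The power series all of whose terms have total degree at least `n`. -/
def orderGE (n : ℕ) : Submodule K (MvPowerSeries σ A) where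
  carrier := {f | ∀ d : σ →₀ ℕ, d.degree < n → MvPowerSeries.coeff d f = 0}
  add_mem' hf hg d hd := by rw [map_add, hf d hd, hg d hd, add_zero]
  zero_mem' _ _ := rfl
  smul_mem' c f hf d hd := by
    change c • MvPowerSeries.coeff d f = 0
    rw [hf d hd, smul_zero]

variable {K}

theorem mem_orderGE_zero (f : MvPowerSeries σ A) : f ∈ orderGE K 0 := fun _ h => absurd h (by simp)

theorem orderGE_anti {m n : ℕ} (h : m ≤ n) {f : MvPowerSeries σ A} (hf : f ∈ orderGE K n) :
    f ∈ orderGE K m := fun d hd => hf d (hd.trans_le h)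

theorem mem_orderGE_one {f : MvPowerSeries σ A} :
    f ∈ orderGE K 1 ↔ MvPowerSeries.coeff 0 f = 0 := by
  refine ⟨fun h => h 0 (by simp), fun h d hd => ?_⟩
  have : d = 0 := (Finsupp.degree_eq_zero_iff d).1 (by omega)
  rw [this, h]

theorem coeff_smul' (c : K) (f : MvPowerSeries σ A) (d : σ →₀ ℕ) :
    MvPowerSeries.coeff d (c • f) = c • MvPowerSeries.coeff d f := rfl

theorem eq_of_sub_mem_orderGE {f g : MvPowerSeries σ A} (h : ∀ n, f - g ∈ orderGE K n) : f = g := by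
  ext d
  have := h (d.degree + 1) d (by omega)
  rwa [map_sub, sub_eq_zero] at this

theorem mul_mem_orderGE {m n k : ℕ} {f g : MvPowerSeries σ A} (hf : f ∈ orderGE K m)
    (hg : g ∈ orderGE K n) (hk : k ≤ m + n) : f * g ∈ orderGE K k := by
  classical
  intro d hd
  rw [MvPowerSeries.coeff_mul]
  refine Finset.sum_eq_zero fun p hp => ?_
  have hp' : p.1.degree + p.2.degree = d.degree := by
    rw [← map_add, HasAntidiagonal.mem_antidiagonal.1 hp]
  by_cases h : p.1.degree < m
  · rw [hf _ h, zero_mul]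
  · rw [hg _ (by omega), mul_zero]

theorem pow_mem_orderGE {f : MvPowerSeries σ A} (hf : f ∈ orderGE K 1) (k : ℕ) :
    f ^ k ∈ orderGE K k := by
  induction k with
  | zero => exact mem_orderGE_zero _
  | succ k ih => exact pow_succ f k ▸ mul_mem_orderGE ih hf le_rfl

/-- The sum of a sequence of power series whose `k`-th member has order at least `k`. -/
def locSum (u : ℕ → MvPowerSeries σ A) : MvPowerSeries σ A := fun d =>
  ∑ k ∈ range (d.degree + 1), MvPowerSeries.coeff d (u k)

theorem coeff_locSum (u : ℕ → MvPowerSeries σ A) (d : σ →₀ ℕ) :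
    MvPowerSeries.coeff d (locSum u) =
      ∑ k ∈ range (d.degree + 1), MvPowerSeries.coeff d (u k) := rfl

/-- The cutoff in `locSum` depends on the index `d`. Being able to enlarge it allows one common
cutoff for all factors of a product. -/
theorem coeff_locSum_of_lt {u : ℕ → MvPowerSeries σ A} (hu : ∀ k, u k ∈ orderGE K k)
    {d : σ →₀ ℕ} {N : ℕ} (hN : d.degree < N) :
    MvPowerSeries.coeff d (locSum u) = ∑ k ∈ range N, MvPowerSeries.coeff d (u k) := by
  rw [coeff_locSum]
  refine Finset.sum_subset (by simpa using hN) fun k _ hk => hu k d ?_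
  simpa using hk

theorem sum_range_mul_sum_range {M : Type*} [AddCommMonoid M] (N : ℕ) (f : ℕ → ℕ → M)
    (hf : ∀ i j, N ≤ i + j → f i j = 0) :
    ∑ i ∈ range N, ∑ j ∈ range N, f i j =
      ∑ n ∈ range N, ∑ p ∈ antidiagonal n, f p.1 p.2 := by
  rw [← Finset.sum_product',
    ← Finset.sum_filter_of_ne (p := fun q : ℕ × ℕ => q.1 + q.2 < N)
      (fun q _ hq => by by_contra h; exact hq (hf _ _ (by omega))),
    ← Finset.sum_fiberwise_of_maps_to (t := range N) (g := fun q : ℕ × ℕ => q.1 + q.2)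
      (by simp)]
  refine Finset.sum_congr rfl fun n hn => Finset.sum_congr ?_ fun _ _ => rfl
  ext q
  simp only [mem_filter, mem_product, mem_range, HasAntidiagonal.mem_antidiagonal] at hn ⊢
  omega

theorem locSum_mul {u v : ℕ → MvPowerSeries σ A} (hu : ∀ k, u k ∈ orderGE K k)
    (hv : ∀ k, v k ∈ orderGE K k) :
    locSum u * locSum v = locSum fun n => ∑ p ∈ antidiagonal n, u p.1 * v p.2 := by
  classical
  ext d
  rw [coeff_locSum]
  simp only [map_sum]
  rw [← sum_range_mul_sum_range (d.degree + 1)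
    (fun i j => MvPowerSeries.coeff d (u i * v j))
    (fun i j h => mul_mem_orderGE (hu i) (hv j) le_rfl d (by omega))]
  simp only [MvPowerSeries.coeff_mul]
  rw [Finset.sum_congr rfl fun i _ => Finset.sum_comm, Finset.sum_comm]
  refine Finset.sum_congr rfl fun p hp => ?_
  have hp' : p.1.degree + p.2.degree = d.degree := by
    rw [← map_add, HasAntidiagonal.mem_antidiagonal.1 hp]
  rw [coeff_locSum_of_lt hu (N := d.degree + 1) (by omega),
    coeff_locSum_of_lt hv (N := d.degree + 1) (by omega), Finset.sum_mul_sum]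

theorem locSum_eq_locSum_succ {u : ℕ → MvPowerSeries σ A} (hu : ∀ k, u k ∈ orderGE K k)
    (h0 : u 0 = 0) : locSum u = locSum fun k => u (k + 1) := by
  ext d
  rw [coeff_locSum_of_lt hu (N := d.degree + 1 + 1) (by omega), Finset.sum_range_succ', h0,
    map_zero, add_zero, coeff_locSum]

theorem locSum_eq_add {u : ℕ → MvPowerSeries σ A} (hu : ∀ k, u k ∈ orderGE K k) :
    locSum u = u 0 + locSum fun k => u (k + 1) := by
  ext d
  rw [coeff_locSum_of_lt hu (N := d.degree + 1 + 1) (by omega), Finset.sum_range_succ', map_add,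
    coeff_locSum, add_comm]

theorem locSum_mem {u : ℕ → MvPowerSeries σ A} {n : ℕ} (hu : ∀ k, u k ∈ orderGE K n) :
    locSum u ∈ orderGE K n := fun d hd => by
  rw [coeff_locSum]
  exact Finset.sum_eq_zero fun k _ => hu k d hd

theorem locSum_sub (u v : ℕ → MvPowerSeries σ A) :
    locSum u - locSum v = locSum fun k => u k - v k := by
  ext d
  simp [coeff_locSum]

theorem locSum_zero : locSum (fun _ => 0 : ℕ → MvPowerSeries σ A) = 0 := by
  ext d
  simp [coeff_locSum]

/-- The power series `∑ k, c k * f ^ k`. -/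
def powSum (c : ℕ → K) (f : MvPowerSeries σ A) : MvPowerSeries σ A := locSum fun k => c k • f ^ k

theorem smul_pow_mem_orderGE (c : ℕ → K) {f : MvPowerSeries σ A} (hf : f ∈ orderGE K 1) (k : ℕ) :
    c k • f ^ k ∈ orderGE K k := Submodule.smul_mem _ _ (pow_mem_orderGE hf k)

theorem formalExp_eq_powSum (f : MvPowerSeries σ A) :
    formalExp K f = powSum (fun k => ((k.factorial : K)⁻¹)) f := rfl

/-- The logarithm starts at `k = 1`, but division by zero gives zero in `K`, so the term `k = 0` may
be included. -/
theorem formalLog_eq_powSum (f : MvPowerSeries σ A) :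
    formalLog K f = powSum (fun k => (-1 : K) ^ (k + 1) / (k : K)) (f - 1) := by
  ext d
  rw [powSum, coeff_locSum]
  change ∑ k ∈ Icc 1 d.degree, _ = _
  refine Finset.sum_subset (fun k hk => by simp at hk ⊢; omega) fun k hk hk' => ?_
  have : k = 0 := by simp at hk hk'; omega
  simp [this]

theorem powSum_mem_one {c : ℕ → K} (hc : c 0 = 0) {f : MvPowerSeries σ A} (hf : f ∈ orderGE K 1) :
    powSum c f ∈ orderGE K 1 := by
  refine locSum_mem fun k => ?_
  rcases Nat.eq_zero_or_pos k with rfl | hk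
  · simp [hc]
  · exact orderGE_anti hk (smul_pow_mem_orderGE c hf k)

/-! ### Evaluation of univariate series along a graded family of linear maps -/

variable {B : Type*} [Ring B] [Algebra K B]

/-- `∑ k, f_k T ^ k ↦ ∑ k, φ_k (f_k)`. -/
def gradedEval (φ : ℕ → B →ₗ[K] MvPowerSeries σ A) (f : MvPowerSeries Unit B) :
    MvPowerSeries σ A :=
  locSum fun k => φ k (PowerSeries.coeff k f)

/-- A family of linear maps which is multiplicative with respect to the degree. -/
structure IsGradedHom (φ : ℕ → B →ₗ[K] MvPowerSeries σ A) : Prop where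
  map_one : φ 0 1 = 1
  map_mul : ∀ i j a b, φ (i + j) (a * b) = φ i a * φ j b

/-- The series on which `gradedEval` is a locally finite sum. -/
def IsEvaluable (φ : ℕ → B →ₗ[K] MvPowerSeries σ A) (f : MvPowerSeries Unit B) : Prop :=
  ∀ k, φ k (PowerSeries.coeff k f) ∈ orderGE K k

variable {φ : ℕ → B →ₗ[K] MvPowerSeries σ A}

theorem IsGradedHom.map_coeff_mul (hφ : IsGradedHom φ) (f g : MvPowerSeries Unit B) (n : ℕ) :
    φ n (PowerSeries.coeff n (f * g)) = ∑ p ∈ antidiagonal n,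
      φ p.1 (PowerSeries.coeff p.1 f) * φ p.2 (PowerSeries.coeff p.2 g) := by
  have h : PowerSeries.coeff n (f * g) = ∑ p ∈ antidiagonal n,
      PowerSeries.coeff p.1 f * PowerSeries.coeff p.2 g := PowerSeries.coeff_mul n f g
  rw [h, map_sum]
  refine Finset.sum_congr rfl fun p hp => ?_
  rw [← hφ.map_mul, HasAntidiagonal.mem_antidiagonal.1 hp]

theorem IsEvaluable.mul (hφ : IsGradedHom φ) {f g : MvPowerSeries Unit B}
    (hf : IsEvaluable φ f) (hg : IsEvaluable φ g) : IsEvaluable φ (f * g) := fun n => by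
  rw [hφ.map_coeff_mul]
  refine Submodule.sum_mem _ fun p hp => ?_
  exact mul_mem_orderGE (hf _) (hg _) (HasAntidiagonal.mem_antidiagonal.1 hp).ge

theorem gradedEval_mul (hφ : IsGradedHom φ) {f g : MvPowerSeries Unit B}
    (hf : IsEvaluable φ f) (hg : IsEvaluable φ g) :
    gradedEval φ (f * g) = gradedEval φ f * gradedEval φ g := by
  rw [gradedEval, gradedEval, gradedEval, locSum_mul hf hg]
  simp only [hφ.map_coeff_mul]

theorem IsEvaluable.one : IsEvaluable φ 1 := fun k => by
  have h : PowerSeries.coeff k (1 : MvPowerSeries Unit B) = if k = 0 then 1 else 0 :=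
    PowerSeries.coeff_one k
  rw [h]
  split_ifs with hk
  · subst hk; exact mem_orderGE_zero _
  · simp

theorem gradedEval_one (hφ : IsGradedHom φ) : gradedEval φ 1 = 1 := by
  have h : ∀ k, PowerSeries.coeff k (1 : MvPowerSeries Unit B) = if k = 0 then 1 else 0 :=
    PowerSeries.coeff_one
  rw [gradedEval, locSum_eq_add (IsEvaluable.one)]
  simp only [h, if_true, hφ.map_one, Nat.add_one_ne_zero, if_false, map_zero, locSum_zero, add_zero]

theorem IsEvaluable.pow (hφ : IsGradedHom φ) {f : MvPowerSeries Unit B}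
    (hf : IsEvaluable φ f) (n : ℕ) : IsEvaluable φ (f ^ n) := by
  induction n with
  | zero => rw [pow_zero]; exact IsEvaluable.one
  | succ n ih => rw [pow_succ]; exact ih.mul hφ hf

theorem gradedEval_pow (hφ : IsGradedHom φ) {f : MvPowerSeries Unit B}
    (hf : IsEvaluable φ f) (n : ℕ) : gradedEval φ (f ^ n) = gradedEval φ f ^ n := by
  induction n with
  | zero => rw [pow_zero, pow_zero, gradedEval_one hφ]
  | succ n ih => rw [pow_succ, gradedEval_mul hφ (hf.pow hφ n) hf, ih, pow_succ]

theorem psCoeff_locSum (u : ℕ → MvPowerSeries Unit B) (k : ℕ) :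
    PowerSeries.coeff k (locSum u) = ∑ n ∈ range (k + 1), PowerSeries.coeff k (u n) := by
  change MvPowerSeries.coeff _ (locSum u) = _
  rw [coeff_locSum, Finsupp.degree_single]
  rfl

theorem psCoeff_eq_zero {n k : ℕ} {f : MvPowerSeries Unit B} (hf : f ∈ orderGE K n) (hk : k < n) :
    PowerSeries.coeff k f = 0 := hf _ (by rwa [Finsupp.degree_single])

theorem IsEvaluable.locSum {u : ℕ → MvPowerSeries Unit B} (hu : ∀ n, IsEvaluable φ (u n)) :
    IsEvaluable φ (locSum u) := fun k => by
  rw [psCoeff_locSum, map_sum]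
  exact Submodule.sum_mem _ fun n _ => hu n k

/-- Interchange of two finite sums: `u n` has no coefficient below degree `n`, so the triangle `n ≤
k` may be completed to a square. -/
theorem gradedEval_locSum {u : ℕ → MvPowerSeries Unit B} (hu : ∀ n, u n ∈ orderGE K n) :
    gradedEval φ (locSum u) = BHL.locSum fun n => gradedEval φ (u n) := by
  ext d
  simp only [gradedEval, coeff_locSum, psCoeff_locSum, map_sum]
  rw [Finset.sum_comm' (t' := range (d.degree + 1)) (s' := fun n => Ico n (d.degree + 1))
    (by simp only [mem_range, mem_Ico]; omega)]
  refine Finset.sum_congr rfl fun n _ => Finset.sum_subset (fun k hk => ?_) fun k hk hk' => ?_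
  · simp only [mem_Ico, mem_range] at hk ⊢; omega
  · simp only [mem_Ico, mem_range] at hk hk'
    rw [psCoeff_eq_zero (hu n) (by omega), map_zero, map_zero]

theorem gradedEval_smul (c : K) (f : MvPowerSeries Unit B) :
    gradedEval φ (c • f) = c • gradedEval φ f := by
  ext d
  have h : ∀ k, PowerSeries.coeff k (c • f) = c • PowerSeries.coeff k f := fun k => rfl
  simp only [coeff_smul', gradedEval, coeff_locSum, h, map_smul, Finset.smul_sum]

/-- Substitution commutes with `exp` and `log`. This serves twice: to replace `X` by `f - 1` in a
scalar identity, and to evaluate the universal Hausdorff series at two given series. -/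
theorem gradedEval_powSum (hφ : IsGradedHom φ) (c : ℕ → K) {f : MvPowerSeries Unit B}
    (hf : IsEvaluable φ f) (h0 : f ∈ orderGE K 1) :
    gradedEval φ (powSum c f) = powSum c (gradedEval φ f) := by
  rw [powSum, gradedEval_locSum (smul_pow_mem_orderGE c h0), powSum]
  simp only [gradedEval_smul, gradedEval_pow hφ hf]

theorem IsEvaluable.powSum (hφ : IsGradedHom φ) (c : ℕ → K) {f : MvPowerSeries Unit B}
    (hf : IsEvaluable φ f) : IsEvaluable φ (powSum c f) :=
  IsEvaluable.locSum fun n k => by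
    have h : PowerSeries.coeff k (c n • f ^ n) = c n • PowerSeries.coeff k (f ^ n) := rfl
    rw [h, map_smul]
    exact Submodule.smul_mem _ _ (hf.pow hφ n k)

theorem IsEvaluable.sub {f g : MvPowerSeries Unit B} (hf : IsEvaluable φ f)
    (hg : IsEvaluable φ g) : IsEvaluable φ (f - g) := fun k => by
  have h : PowerSeries.coeff k (f - g) = PowerSeries.coeff k f - PowerSeries.coeff k g := rfl
  rw [h, map_sub]
  exact Submodule.sub_mem _ (hf k) (hg k)

theorem gradedEval_sub (f g : MvPowerSeries Unit B) :
    gradedEval φ (f - g) = gradedEval φ f - gradedEval φ g := by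
  have h : ∀ k, PowerSeries.coeff k (f - g) = PowerSeries.coeff k f - PowerSeries.coeff k g :=
    fun k => rfl
  simp only [gradedEval, locSum_sub, h, map_sub]

/-! ### The Euler derivation and the derivative of the exponential -/

variable (K)

/-- The Euler derivation, which multiplies the terms of total degree `n` by `n`. -/
def euler : MvPowerSeries σ A →ₗ[K] MvPowerSeries σ A where
  toFun f := fun d => (d.degree : K) • MvPowerSeries.coeff d f
  map_add' f g := by
    funext d
    exact smul_add _ _ _
  map_smul' c f := by
    funext d
    exact smul_comm _ _ _

variable {K}

theorem coeff_euler (f : MvPowerSeries σ A) (d : σ →₀ ℕ) :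
    MvPowerSeries.coeff d (euler K f) = (d.degree : K) • MvPowerSeries.coeff d f := rfl

theorem euler_mul (f g : MvPowerSeries σ A) :
    euler K (f * g) = euler K f * g + f * euler K g := by
  classical
  ext d
  rw [coeff_euler, map_add, MvPowerSeries.coeff_mul, MvPowerSeries.coeff_mul,
    MvPowerSeries.coeff_mul, Finset.smul_sum, ← Finset.sum_add_distrib]
  refine Finset.sum_congr rfl fun p hp => ?_
  rw [← HasAntidiagonal.mem_antidiagonal.1 hp, map_add, Nat.cast_add, add_smul, coeff_euler,
    coeff_euler, smul_mul_assoc, mul_smul_comm]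

theorem euler_mem {n : ℕ} {f : MvPowerSeries σ A} (hf : f ∈ orderGE K n) :
    euler K f ∈ orderGE K n := fun d hd => by rw [coeff_euler, hf d hd, smul_zero]

theorem euler_locSum (u : ℕ → MvPowerSeries σ A) :
    euler K (locSum u) = locSum fun k => euler K (u k) := by
  ext d
  simp only [coeff_euler, coeff_locSum, Finset.smul_sum]

theorem euler_one : euler K (1 : MvPowerSeries σ A) = 0 := by
  classical
  ext d
  rw [coeff_euler, MvPowerSeries.coeff_one]
  split_ifs with h <;> simp [h]

/-! ### Powers and iterated commutators -/

section Commutator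

variable (K) {R : Type*} [Ring R] [Algebra K R]

/-- The map `w ↦ z * w - w * z`. -/
def commutator (z : R) : Module.End K R := LinearMap.mulLeft K z - LinearMap.mulRight K z

variable {K}

theorem commutator_apply (z w : R) : commutator K z w = z * w - w * z := rfl

theorem commute_commutator_mulRight (z : R) :
    Commute (commutator K z) (LinearMap.mulRight K z) :=
  (LinearMap.commute_mulLeft_right (R := K) z z).sub_left (Commute.refl _)

theorem mulRight_pow_apply (z w : R) (n : ℕ) : (LinearMap.mulRight K z ^ n) w = w * z ^ n := by
  rw [LinearMap.pow_mulRight, LinearMap.mulRight_apply]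

/-- Left multiplication by `z` is `ad z` plus right multiplication by `z`, and these two commute, so
the binomial theorem applies. -/
theorem pow_mul_eq_sum_commutator (z w : R) (n : ℕ) :
    z ^ n * w = ∑ p ∈ antidiagonal n,
      n.choose p.1 • ((commutator K z ^ p.1) w * z ^ p.2) := by
  have h := (commute_commutator_mulRight (K := K) z).add_pow' n
  rw [commutator, sub_add_cancel] at h
  have h2 := congrArg (fun f : Module.End K R => f w) h
  simp only [LinearMap.pow_mulLeft, LinearMap.mulLeft_apply, LinearMap.sum_apply,
    LinearMap.smul_apply] at h2
  rw [h2]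
  refine Finset.sum_congr rfl fun p _ => ?_
  congr 1
  change (commutator K z ^ p.1 * LinearMap.mulRight K z ^ p.2) w = _
  rw [((commute_commutator_mulRight (K := K) z).pow_pow p.1 p.2).eq]
  rw [Module.End.mul_apply, mulRight_pow_apply]

/-- Induction by the Leibniz rule and Pascal's rule. Divided by `(n + 1)!` and summed, it gives
`D(exp z) = ((exp(ad z) - 1) / ad z)(D z) · exp z`. -/
theorem derivation_pow_eq_sum_commutator (D : R →ₗ[K] R)
    (hD : ∀ f g, D (f * g) = D f * g + f * D g) (z : R) (n : ℕ) :
    D (z ^ (n + 1)) = ∑ p ∈ antidiagonal n,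
      (n + 1).choose (p.1 + 1) • ((commutator K z ^ p.1) (D z) * z ^ p.2) := by
  induction n with
  | zero => simp
  | succ n ih =>
    rw [pow_succ, hD, pow_mul_eq_sum_commutator (K := K), ih]
    simp only [Nat.choose_succ_succ (n + 1), add_smul, Finset.sum_add_distrib]
    rw [add_comm]
    congr 1
    rw [Finset.Nat.sum_antidiagonal_succ', Finset.sum_mul]
    simp only [Nat.succ_eq_add_one, Nat.choose_succ_self, zero_smul, smul_mul_assoc,
      mul_assoc, ← pow_succ]
    simp

end Commutator

theorem inv_factorial_mul_choose [CharZero K] {n : ℕ} {p : ℕ × ℕ} (hp : p ∈ antidiagonal n) :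
    ((n.factorial : K)⁻¹) * (n.choose p.1 : K) =
      (p.1.factorial : K)⁻¹ * (p.2.factorial : K)⁻¹ := by
  have h : p.1 + p.2 = n := HasAntidiagonal.mem_antidiagonal.1 hp
  have h1 : ((p.1 + p.2).choose p.2 * p.1.factorial * p.2.factorial : K) = (p.1+p.2).factorial := by
    exact_mod_cast Nat.add_choose_mul_factorial_mul_factorial p.1 p.2
  have h2 : (n.factorial : K) ≠ 0 := by exact_mod_cast n.factorial_ne_zero
  have h3 : (p.1.factorial : K) ≠ 0 := by exact_mod_cast p.1.factorial_ne_zero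
  have h4 : (p.2.factorial : K) ≠ 0 := by exact_mod_cast p.2.factorial_ne_zero
  rw [Nat.choose_symm_add.symm, h] at h1
  field_simp
  exact h1

theorem commutator_pow_mem {z w : MvPowerSeries σ A} (hz : z ∈ orderGE K 1) {n : ℕ}
    (hw : w ∈ orderGE K n) (k : ℕ) : (commutator K z ^ k) w ∈ orderGE K (k + n) := by
  induction k with
  | zero => simpa using hw
  | succ k ih =>
    rw [pow_succ', Module.End.mul_apply, commutator_apply]
    exact Submodule.sub_mem _ (mul_mem_orderGE hz ih (by omega)) (mul_mem_orderGE ih hz (by omega))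

variable [CharZero K]

/-- This is `exp(z) w exp(-z) = exp(ad z)(w)`, written without the inverse. -/
theorem formalExp_mul {z : MvPowerSeries σ A} (hz : z ∈ orderGE K 1) (w : MvPowerSeries σ A) :
    formalExp K z * w =
      locSum (fun k => ((k.factorial : K)⁻¹) • (commutator K z ^ k) w) * formalExp K z := by
  have hz' : ∀ k, (fun k : ℕ => ((k.factorial : K)⁻¹) • z ^ k) k ∈ orderGE K k :=
    smul_pow_mem_orderGE (fun k => (k.factorial : K)⁻¹) hz
  rw [formalExp_eq_powSum, powSum, locSum_mul _ hz']
  -- Writing `w` as a series concentrated in index `0` makes the left side a Cauchy product too.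
  · have hw : w = locSum fun k => if k = 0 then w else 0 := by
      rw [locSum_eq_add (K := K)]
      · simp [locSum_zero]
      · intro k
        split_ifs with h
        · exact h ▸ mem_orderGE_zero _
        · exact Submodule.zero_mem _
    conv_lhs => rw [hw]
    rw [locSum_mul hz']
    · congr 1
      funext n
      rw [Finset.Nat.sum_antidiagonal_eq_sum_range_succ_mk, Finset.sum_eq_single n]
      · simp only [Nat.sub_self, if_true, smul_mul_assoc]
        rw [pow_mul_eq_sum_commutator (K := K), Finset.smul_sum]
        refine Finset.sum_congr rfl fun p hp => ?_
        rw [← Nat.cast_smul_eq_nsmul K, smul_smul, inv_factorial_mul_choose hp, mul_smul_comm,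
          smul_smul]
      · intro k hk hkn
        rw [if_neg (by simp at hk; omega), mul_zero]
      · simp
    · intro k
      split_ifs with h
      · exact h ▸ mem_orderGE_zero _
      · exact Submodule.zero_mem _
  · intro k
    exact Submodule.smul_mem _ _ (commutator_pow_mem hz (mem_orderGE_zero w) k)

/-- The derivative of the exponential of a noncommutative power series. -/
theorem euler_formalExp {z : MvPowerSeries σ A} (hz : z ∈ orderGE K 1) :
    euler K (formalExp K z) =
      locSum (fun k => (((k + 1).factorial : K)⁻¹) • (commutator K z ^ k) (euler K z)) *
        formalExp K z := by
  have hz' : ∀ k, (fun k : ℕ => ((k.factorial : K)⁻¹) • z ^ k) k ∈ orderGE K k :=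
    smul_pow_mem_orderGE (fun k => (k.factorial : K)⁻¹) hz
  rw [formalExp_eq_powSum, powSum, locSum_mul _ hz', euler_locSum,
    locSum_eq_locSum_succ (fun k => euler_mem (hz' k)) (by simp [euler_one])]
  · congr 1
    funext n
    rw [map_smul, derivation_pow_eq_sum_commutator _ euler_mul, Finset.smul_sum]
    refine Finset.sum_congr rfl fun p hp => ?_
    -- The term `k = 0` of the exponential has been dropped, so the binomial coefficient belongs to
    -- the shifted pair on the antidiagonal of `n + 1`.
    rw [← Nat.cast_smul_eq_nsmul K, smul_smul, inv_factorial_mul_choose (p := (p.1 + 1, p.2)),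
      smul_mul_smul_comm]
    simp only [HasAntidiagonal.mem_antidiagonal] at hp ⊢
    omega
  · intro k
    exact Submodule.smul_mem _ _ (commutator_pow_mem hz (mem_orderGE_zero _) k)

end LocallyFinite

end

end BHL

namespace BHL

noncomputable section

/-! ### The exponential and the logarithm are mutually inverse -/

section ExpLogInverse

variable {K : Type*} [Field K] {σ A : Type*} [Ring A] [Algebra K A]

theorem gradedEval_add {B : Type*} [Ring B] [Algebra K B] {φ : ℕ → B →ₗ[K] MvPowerSeries σ A}
    (f g : MvPowerSeries Unit B) :
    gradedEval φ (f + g) = gradedEval φ f + gradedEval φ g := by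
  have h := gradedEval_sub (φ := φ) (f + g) g
  rw [add_sub_cancel_right] at h
  rw [h, sub_add_cancel]

theorem locSum_commutator_of_commute {z w : MvPowerSeries σ A} (hz : z ∈ orderGE K 1)
    (h : Commute z w) (c : ℕ → K) :
    locSum (fun k => c k • (commutator K z ^ k) w) = c 0 • w := by
  have h0 : ∀ k, (commutator K z ^ (k + 1)) w = 0 := fun k => by
    rw [pow_succ, Module.End.mul_apply, commutator_apply, h.eq, sub_self, map_zero]
  rw [locSum_eq_add (fun k => Submodule.smul_mem _ _
    (commutator_pow_mem hz (mem_orderGE_zero w) k))]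
  simp [h0, locSum_zero]

theorem powSum_eq_add (c : ℕ → K) {f : MvPowerSeries σ A} (hf : f ∈ orderGE K 1) :
    powSum c f = c 0 • 1 + locSum fun k => c (k + 1) • f ^ (k + 1) := by
  rw [powSum, locSum_eq_add (smul_pow_mem_orderGE c hf), pow_zero]

theorem formalExp_sub_one_mem {f : MvPowerSeries σ A} (hf : f ∈ orderGE K 1) :
    formalExp K f - 1 ∈ orderGE K 1 := by
  rw [formalExp_eq_powSum, powSum_eq_add _ hf, Nat.factorial_zero, Nat.cast_one, inv_one, one_smul,
    add_sub_cancel_left]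
  exact locSum_mem fun k => orderGE_anti (by omega)
    (smul_pow_mem_orderGE (fun k => (k.factorial : K)⁻¹) hf (k + 1))

theorem formalExp_zero : formalExp K (0 : MvPowerSeries σ A) = 1 := by
  rw [formalExp_eq_powSum, powSum_eq_add _ (Submodule.zero_mem _)]
  simp [locSum_zero]

theorem mul_sub_one_mem {f g : MvPowerSeries σ A} (hf : f - 1 ∈ orderGE K 1)
    (hg : g - 1 ∈ orderGE K 1) : f * g - 1 ∈ orderGE K 1 := by
  have h : f * g - 1 = (f - 1) * g + (g - 1) := by noncomm_ring
  rw [h]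
  exact Submodule.add_mem _ (mul_mem_orderGE hf (mem_orderGE_zero g) (by omega)) hg

theorem formalLog_mem {f : MvPowerSeries σ A} (hf : f - 1 ∈ orderGE K 1) :
    formalLog K f ∈ orderGE K 1 := by
  rw [formalLog_eq_powSum]
  exact powSum_mem_one (by simp) hf

/-- From `(f - f') g = 0` follows `f - f' = -(f - f')(g - 1)`, which raises the order of `f - f'` by
one each time. -/
theorem mul_right_cancel_of_sub_one_mem {f f' g : MvPowerSeries σ A} (hg : g - 1 ∈ orderGE K 1)
    (h : f * g = f' * g) : f = f' := by
  refine eq_of_sub_mem_orderGE (K := K) fun n => ?_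
  induction n with
  | zero => exact mem_orderGE_zero _
  | succ n ih =>
    have h2 : f - f' = -((f - f') * (g - 1)) := by
      rw [mul_sub, sub_mul, h, sub_self, zero_sub, neg_neg, mul_one]
    rw [h2]
    exact Submodule.neg_mem _ (mul_mem_orderGE ih hg le_rfl)

theorem psCoeff_powSum_X (c : ℕ → K) (n : ℕ) :
    PowerSeries.coeff n (powSum c (PowerSeries.X : PowerSeries K)) = c n := by
  rw [powSum, psCoeff_locSum, Finset.sum_eq_single n]
  · have h : PowerSeries.coeff n (c n • (PowerSeries.X : PowerSeries K) ^ n) =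
      c n • PowerSeries.coeff n ((PowerSeries.X : PowerSeries K) ^ n) := rfl
    refine h.trans ?_
    rw [PowerSeries.coeff_X_pow_self, smul_eq_mul, mul_one]
  · intro k _ hk
    have h : PowerSeries.coeff n (c k • (PowerSeries.X : PowerSeries K) ^ k) =
      c k • PowerSeries.coeff n ((PowerSeries.X : PowerSeries K) ^ k) := rfl
    refine h.trans ?_
    rw [PowerSeries.coeff_X_pow, if_neg (Ne.symm hk), smul_zero]
  · simp

theorem psCoeff_euler {B : Type*} [Ring B] [Algebra K B] (f : PowerSeries B) (n : ℕ) :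
    PowerSeries.coeff n (euler K f : PowerSeries B) = (n : K) • PowerSeries.coeff n f := by
  change MvPowerSeries.coeff _ (euler K f) = _
  rw [coeff_euler, Finsupp.degree_single]
  rfl

theorem X_mem_orderGE : (PowerSeries.X : PowerSeries K) ∈ orderGE (σ := Unit) K 1 :=
  mem_orderGE_one.2 (MvPowerSeries.coeff_zero_X (R := K) ())

/-- With `l = log(1 + X)`, the series `E = exp l` satisfies `(1 + X) · X E' = X · E`. The resulting
recursion and `E(0) = 1` determine `E`. -/
theorem formalExp_logSeries [CharZero K] :
    formalExp K (powSum (fun k => (-1 : K) ^ (k + 1) / (k : K)) (PowerSeries.X : PowerSeries K)) =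
      1 + (PowerSeries.X : PowerSeries K) := by
  set l : PowerSeries K :=
    powSum (fun k => (-1 : K) ^ (k + 1) / (k : K)) (PowerSeries.X : PowerSeries K) with hl
  have hlm : l ∈ orderGE (σ := Unit) K 1 := powSum_mem_one (by simp) X_mem_orderGE
  have hlc : ∀ n, PowerSeries.coeff n l = (-1 : K) ^ (n + 1) / (n : K) := psCoeff_powSum_X _
  set E : PowerSeries K := formalExp K l with hE
  have hD : (euler K E : PowerSeries K) = (euler K l : PowerSeries K) * E := by
    rw [hE, euler_formalExp hlm]
    rw [locSum_commutator_of_commute hlm (Commute.all (S := PowerSeries K) _ _)]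
    simp
  have hDl : (1 + PowerSeries.X) * (euler K l : PowerSeries K) = PowerSeries.X := by
    ext n
    rw [add_mul, one_mul, map_add, psCoeff_euler, hlc]
    rcases n with _ | n
    · simp
    · rw [PowerSeries.coeff_succ_X_mul, psCoeff_euler, hlc, PowerSeries.coeff_X]
      rcases n with _ | n
      · simp
      · have h1 : ((n : K) + 1) ≠ 0 := by exact_mod_cast n.succ_ne_zero
        have h2 : ((n : K) + 1 + 1) ≠ 0 := by exact_mod_cast (n + 1).succ_ne_zero
        rw [if_neg (by omega)]
        push_cast
        simp only [smul_eq_mul]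
        field_simp
        ring
  have hode : (1 + PowerSeries.X) * (euler K E : PowerSeries K) = PowerSeries.X * E := by
    rw [hD, ← mul_assoc, hDl]
  have hrec : ∀ n : ℕ, ((n : K) + 1) * PowerSeries.coeff (n + 1) E =
      (1 - (n : K)) * PowerSeries.coeff n E := by
    intro n
    have h := congrArg (PowerSeries.coeff (n + 1)) hode
    rw [add_mul, one_mul, map_add, psCoeff_euler, PowerSeries.coeff_succ_X_mul,
      PowerSeries.coeff_succ_X_mul, psCoeff_euler] at h
    simp only [smul_eq_mul, Nat.cast_add, Nat.cast_one] at h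
    linear_combination h
  have h0 : PowerSeries.coeff 0 E = 1 := by
    have h := psCoeff_eq_zero (formalExp_sub_one_mem hlm) zero_lt_one
    have h' : PowerSeries.coeff 0 E - PowerSeries.coeff 0 (1 : PowerSeries K) = 0 := by
      rw [← map_sub]; exact h
    rw [PowerSeries.coeff_zero_one, sub_eq_zero] at h'
    exact h'
  have h1 : PowerSeries.coeff 1 E = 1 := by
    have := hrec 0
    simpa [h0] using this
  -- The factor `1 - n` vanishes at `n = 1`, which kills the coefficient of `X ^ 2` and then all
  -- later ones.
  have h2 : ∀ n, PowerSeries.coeff (n + 2) E = 0 := by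
    intro n
    induction n with
    | zero =>
      have h := hrec 1
      simp only [Nat.cast_one, sub_self, zero_mul, mul_eq_zero] at h
      rcases h with h | h
      · norm_num at h
      · exact h
    | succ n ih =>
      have h := hrec (n + 2)
      rw [ih, mul_zero, mul_eq_zero] at h
      rcases h with h | h
      · exact absurd h (by exact_mod_cast (n + 2).succ_ne_zero)
      · exact h
  have key : E = 1 + PowerSeries.X := by
    ext n
    rw [map_add, PowerSeries.coeff_one, PowerSeries.coeff_X]
    match n with
    | 0 => simpa using h0
    | 1 => simpa using h1
    | n + 2 => rw [h2]; simp
  exact key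

/-- Only powers of `u = f - 1` occur, so the identity is the image of the one in `K[[X]]` under `X ↦
u`. -/
theorem formalExp_formalLog [CharZero K] {f : MvPowerSeries σ A} (hf : f - 1 ∈ orderGE K 1) :
    formalExp K (formalLog K f) = f := by
  set u := f - 1 with hu
  let φ : ℕ → K →ₗ[K] MvPowerSeries σ A := fun k => LinearMap.toSpanSingleton K _ (u ^ k)
  have hφ : IsGradedHom φ := by
    refine ⟨by simp [φ], fun i j a b => ?_⟩
    simp only [φ, LinearMap.toSpanSingleton_apply, pow_add, smul_mul_smul_comm]
  have hev : ∀ p : MvPowerSeries Unit K, IsEvaluable φ p := fun p k =>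
    Submodule.smul_mem _ _ (pow_mem_orderGE hf k)
  have hX : gradedEval φ (PowerSeries.X : PowerSeries K) = u := by
    rw [gradedEval, locSum_eq_add (hev _), locSum_eq_add (K := K)]
    · simp [φ, PowerSeries.coeff_X, locSum_zero]
    · exact fun k => orderGE_anti k.le_succ (hev _ (k + 1))
  rw [formalLog_eq_powSum, ← hu, formalExp_eq_powSum]
  have hXm := X_mem_orderGE (K := K)
  conv_lhs => rw [← hX]
  rw [← gradedEval_powSum hφ _ (hev _) hXm,
    ← gradedEval_powSum hφ _ (hev _) (powSum_mem_one (by simp) hXm), ← formalExp_eq_powSum,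
    formalExp_logSeries]
  refine (gradedEval_add _ _).trans ?_
  rw [hX, gradedEval_one hφ, hu, add_sub_cancel]

/-- To leading order a power series map is its linear term: for `k ≥ 2` the difference `f ^ k - g ^
k` gains at least one degree over `f - g`. Injectivity of `exp` and the contraction property of
`BCH` come from here. -/
theorem powSum_sub_mem (c : ℕ → K) {n : ℕ} {f g : MvPowerSeries σ A} (hf : f ∈ orderGE K 1)
    (hg : g ∈ orderGE K 1) (hfg : f - g ∈ orderGE K n) :
    powSum c f - powSum c g - c 1 • (f - g) ∈ orderGE K (n + 1) := by
  have hpow : ∀ k, f ^ (k + 1) - g ^ (k + 1) ∈ orderGE K (n + k) := by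
    intro k
    induction k with
    | zero => simpa using hfg
    | succ k ih =>
      have h : f ^ (k + 1 + 1) - g ^ (k + 1 + 1) =
          f ^ (k + 1) * (f - g) + (f ^ (k + 1) - g ^ (k + 1)) * g := by
        rw [pow_succ f (k + 1), pow_succ g (k + 1)]
        noncomm_ring
      rw [h]
      exact Submodule.add_mem _ (mul_mem_orderGE (pow_mem_orderGE hf _) hfg (by omega))
        (mul_mem_orderGE ih hg (by omega))
  have hu : ∀ k, c k • f ^ k - c k • g ^ k ∈ orderGE K k := fun k =>
    Submodule.sub_mem _ (smul_pow_mem_orderGE c hf k) (smul_pow_mem_orderGE c hg k)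
  rw [powSum, powSum, locSum_sub, locSum_eq_add hu, locSum_eq_add (K := K)
    (fun k => orderGE_anti k.le_succ (hu (k + 1)))]
  simp only [pow_zero, sub_self, zero_add, pow_one, ← smul_sub, add_sub_cancel_left]
  exact locSum_mem fun k => Submodule.smul_mem _ _ (orderGE_anti (by omega) (hpow (k + 1)))

theorem formalExp_sub_mem {n : ℕ} {f g : MvPowerSeries σ A} (hf : f ∈ orderGE K 1)
    (hg : g ∈ orderGE K 1) (hfg : f - g ∈ orderGE K n) :
    formalExp K f - formalExp K g - (f - g) ∈ orderGE K (n + 1) := by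
  simpa [formalExp_eq_powSum] using powSum_sub_mem (fun k => (k.factorial : K)⁻¹) hf hg hfg

theorem formalLog_sub_mem {n : ℕ} {f g : MvPowerSeries σ A} (hf : f - 1 ∈ orderGE K 1)
    (hg : g - 1 ∈ orderGE K 1) (hfg : f - g ∈ orderGE K n) :
    formalLog K f - formalLog K g - (f - g) ∈ orderGE K (n + 1) := by
  have h := powSum_sub_mem (fun k => (-1 : K) ^ (k + 1) / (k : K)) hf hg
    (by rwa [sub_sub_sub_cancel_right])
  rw [sub_sub_sub_cancel_right, ← formalLog_eq_powSum, ← formalLog_eq_powSum] at h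
  simpa using h

theorem formalExp_injOn {f g : MvPowerSeries σ A} (hf : f ∈ orderGE K 1) (hg : g ∈ orderGE K 1)
    (h : formalExp K f = formalExp K g) : f = g := by
  refine eq_of_sub_mem_orderGE (K := K) fun n => ?_
  induction n with
  | zero => exact mem_orderGE_zero _
  | succ n ih =>
    have h2 := formalExp_sub_mem hf hg ih
    rw [h, sub_self, zero_sub] at h2
    exact neg_mem_iff.1 h2

theorem formalLog_formalExp [CharZero K] {f : MvPowerSeries σ A} (hf : f ∈ orderGE K 1) :
    formalLog K (formalExp K f) = f :=
  formalExp_injOn (formalLog_mem (formalExp_sub_one_mem hf)) hf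
    (formalExp_formalLog (formalExp_sub_one_mem hf))

end ExpLogInverse

/-! ### The Hausdorff series in an associative algebra -/

section HausdorffSeries

variable (K : Type*) [Field K] {σ A : Type*} [Ring A] [Algebra K A]

/-- `log (exp x * exp y)`. -/
def hausdorff (x y : MvPowerSeries σ A) : MvPowerSeries σ A :=
  formalLog K (formalExp K x * formalExp K y)

variable {K} {x y x' y' : MvPowerSeries σ A}

theorem formalExp_mul_sub_one_mem (hx : x ∈ orderGE K 1) (hy : y ∈ orderGE K 1) :
    formalExp K x * formalExp K y - 1 ∈ orderGE K 1 :=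
  mul_sub_one_mem (formalExp_sub_one_mem hx) (formalExp_sub_one_mem hy)

theorem hausdorff_mem (hx : x ∈ orderGE K 1) (hy : y ∈ orderGE K 1) :
    hausdorff K x y ∈ orderGE K 1 := formalLog_mem (formalExp_mul_sub_one_mem hx hy)

/-- The contraction estimate. Modulo one more degree `exp`, the product of series with constant term
`1`, and `log` all act on differences by their linear parts, and subtracting `x + y` removes exactly
that part. -/
theorem hausdorff_sub_mem (hx : x ∈ orderGE K 1) (hy : y ∈ orderGE K 1) (hx' : x' ∈ orderGE K 1)
    (hy' : y' ∈ orderGE K 1) {n : ℕ} (hxx : x - x' ∈ orderGE K n) (hyy : y - y' ∈ orderGE K n) :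
    (hausdorff K x y - x - y) - (hausdorff K x' y' - x' - y') ∈ orderGE K (n + 1) := by
  have h1 := formalExp_sub_mem hx hx' hxx
  have h2 := formalExp_sub_mem hy hy' hyy
  have h1' : formalExp K x - formalExp K x' ∈ orderGE K n := by
    have := Submodule.add_mem _ (orderGE_anti n.le_succ h1) hxx
    rwa [sub_add_cancel] at this
  have h2' : formalExp K y - formalExp K y' ∈ orderGE K n := by
    have := Submodule.add_mem _ (orderGE_anti n.le_succ h2) hyy
    rwa [sub_add_cancel] at this
  have h3 : formalExp K x * formalExp K y - formalExp K x' * formalExp K y' -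
      ((x - x') + (y - y')) ∈ orderGE K (n + 1) := by
    have h : formalExp K x * formalExp K y - formalExp K x' * formalExp K y' -
      ((x - x') + (y - y')) = (formalExp K x - formalExp K x') * (formalExp K y - 1) +
        (formalExp K x' - 1) * (formalExp K y - formalExp K y') +
        ((formalExp K x - formalExp K x' - (x - x')) +
          (formalExp K y - formalExp K y' - (y - y'))) := by noncomm_ring
    rw [h]
    exact Submodule.add_mem _ (Submodule.add_mem _
      (mul_mem_orderGE h1' (formalExp_sub_one_mem hy) le_rfl)
      (mul_mem_orderGE (formalExp_sub_one_mem hx') h2' (by omega))) (Submodule.add_mem _ h1 h2)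
  have h3' : formalExp K x * formalExp K y - formalExp K x' * formalExp K y' ∈ orderGE K n := by
    have := Submodule.add_mem _ (orderGE_anti n.le_succ h3) (Submodule.add_mem _ hxx hyy)
    rwa [sub_add_cancel] at this
  have h4 := formalLog_sub_mem (formalExp_mul_sub_one_mem hx hy) (formalExp_mul_sub_one_mem hx' hy')
    h3'
  have h5 := Submodule.add_mem _ h4 h3
  convert h5 using 1
  rw [hausdorff, hausdorff]
  abel

theorem formalExp_hausdorff [CharZero K] (hx : x ∈ orderGE K 1) (hy : y ∈ orderGE K 1) :
    formalExp K (hausdorff K x y) = formalExp K x * formalExp K y :=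
  formalExp_formalLog (formalExp_mul_sub_one_mem hx hy)

/-! ### Setting a variable equal to zero -/

section ZeroVar

open Classical in
/-- The power series obtained by setting the variable `i` equal to zero. -/
def zeroVar (i : σ) (f : MvPowerSeries σ A) : MvPowerSeries σ A := fun d =>
  if d i = 0 then MvPowerSeries.coeff d f else 0

omit [Field K] [Algebra K A] in
theorem coeff_zeroVar (i : σ) (f : MvPowerSeries σ A) (d : σ →₀ ℕ) :
    MvPowerSeries.coeff d (zeroVar i f) = if d i = 0 then MvPowerSeries.coeff d f else 0 := by
  change (if d i = 0 then MvPowerSeries.coeff d f else 0 : A) = _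
  congr

theorem zeroVar_mul (i : σ) (f g : MvPowerSeries σ A) :
    zeroVar i (f * g) = zeroVar i f * zeroVar i g := by
  classical
  ext d
  simp only [coeff_zeroVar, MvPowerSeries.coeff_mul]
  split_ifs with h
  · refine Finset.sum_congr rfl fun p hp => ?_
    have h2 : p.1 i + p.2 i = d i := by
      rw [← HasAntidiagonal.mem_antidiagonal.1 hp]; rfl
    rw [if_pos (by omega), if_pos (by omega)]
  · refine (Finset.sum_eq_zero fun p hp => ?_).symm
    have h2 : p.1 i + p.2 i = d i := by
      rw [← HasAntidiagonal.mem_antidiagonal.1 hp]; rfl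
    by_cases h3 : p.1 i = 0
    · rw [if_neg (by omega : ¬ p.2 i = 0), mul_zero]
    · rw [if_neg h3, zero_mul]

theorem zeroVar_one (i : σ) : zeroVar i (1 : MvPowerSeries σ A) = 1 := by
  classical
  ext d
  rw [coeff_zeroVar, MvPowerSeries.coeff_one]
  split_ifs with h1 h2 h3
  · rfl
  · rfl
  · exact absurd (by simp [h3]) h1
  · rfl

theorem zeroVar_pow (i : σ) (f : MvPowerSeries σ A) (n : ℕ) :
    zeroVar i (f ^ n) = zeroVar i f ^ n := by
  induction n with
  | zero => simp [zeroVar_one]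
  | succ n ih => rw [pow_succ, zeroVar_mul, ih, pow_succ]

theorem zeroVar_sub (i : σ) (f g : MvPowerSeries σ A) :
    zeroVar i (f - g) = zeroVar i f - zeroVar i g := by
  ext d
  simp only [coeff_zeroVar, map_sub]
  split_ifs <;> simp

theorem zeroVar_powSum (i : σ) (c : ℕ → K) (f : MvPowerSeries σ A) :
    zeroVar i (powSum c f) = powSum c (zeroVar i f) := by
  ext d
  simp only [powSum, coeff_zeroVar, coeff_locSum, coeff_smul', ← zeroVar_pow]
  split_ifs <;> simp

theorem zeroVar_mem (i : σ) {f : MvPowerSeries σ A} {n : ℕ} (hf : f ∈ orderGE K n) :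
    zeroVar i f ∈ orderGE K n := fun d hd => by
  rw [coeff_zeroVar, hf d hd, ite_self]

theorem zeroVar_hausdorff (i : σ) (x y : MvPowerSeries σ A) :
    zeroVar i (hausdorff K x y) = hausdorff K (zeroVar i x) (zeroVar i y) := by
  simp only [hausdorff, formalLog_eq_powSum, formalExp_eq_powSum, zeroVar_powSum, zeroVar_sub,
    zeroVar_mul, zeroVar_one]

theorem zeroVar_hausdorff_of_right [CharZero K] (i : σ) (hx : x ∈ orderGE K 1) (hy : zeroVar i y = 0) :
    zeroVar i (hausdorff K x y) = zeroVar i x := by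
  rw [zeroVar_hausdorff, hy, hausdorff, formalExp_zero, mul_one,
    formalLog_formalExp (zeroVar_mem i hx)]

theorem zeroVar_hausdorff_of_left [CharZero K] (i : σ) (hy : y ∈ orderGE K 1) (hx : zeroVar i x = 0) :
    zeroVar i (hausdorff K x y) = zeroVar i y := by
  rw [zeroVar_hausdorff, hx, hausdorff, formalExp_zero, one_mul,
    formalLog_formalExp (zeroVar_mem i hy)]

end ZeroVar

end HausdorffSeries

end

end BHL

namespace BHL

noncomputable section

/-! ### The Hausdorff series is a Lie series -/

section LieSeriesProperty

variable {K : Type*} [Field K] {σ A : Type*} [Ring A] [Algebra K A]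

/-- The differential equation for the Hausdorff series, for `x` homogeneous of degree one. -/
theorem locSum_commutator_hausdorff [CharZero K] {x y : MvPowerSeries σ A} (hx : x ∈ orderGE K 1)
    (hy : y ∈ orderGE K 1) (hDx : euler K x = x) (hDy : euler K y = y) :
    locSum (fun k => (((k + 1).factorial : K)⁻¹) •
        (commutator K (hausdorff K x y) ^ k) (euler K (hausdorff K x y))) =
      x + locSum fun k => ((k.factorial : K)⁻¹) • (commutator K x ^ k) y := by
  have hexp : ∀ z : MvPowerSeries σ A, z ∈ orderGE K 1 → euler K z = z →
      euler K (formalExp K z) = z * formalExp K z := fun z hz hD => by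
    rw [euler_formalExp hz, hD, locSum_commutator_of_commute hz (Commute.refl z)
      (fun k => ((k + 1).factorial : K)⁻¹)]
    simp
  -- Multiplied on the right by `exp z = exp x exp y`, both sides become the Euler derivative of
  -- this product.
  refine mul_right_cancel_of_sub_one_mem (formalExp_mul_sub_one_mem hx hy) ?_
  rw [← formalExp_hausdorff hx hy, ← euler_formalExp (hausdorff_mem hx hy),
    formalExp_hausdorff hx hy, euler_mul, hexp x hx hDx, hexp y hy hDy, add_mul, mul_assoc,
    ← mul_assoc (formalExp K x), formalExp_mul hx y, mul_assoc]

variable {W : Submodule K A}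

theorem psCoeff_commutator_mem (hW : ∀ a ∈ W, ∀ b ∈ W, a * b - b * a ∈ W)
    {z w : MvPowerSeries Unit A} {n : ℕ}
    (h : ∀ i j, i + j = n → PowerSeries.coeff i z = 0 ∨ PowerSeries.coeff j w = 0 ∨
      (PowerSeries.coeff i z ∈ W ∧ PowerSeries.coeff j w ∈ W)) :
    PowerSeries.coeff n (commutator K z w) ∈ W := by
  have h1 : PowerSeries.coeff n (commutator K z w) =
      PowerSeries.coeff n ((z : PowerSeries A) * w) -
        PowerSeries.coeff n ((w : PowerSeries A) * z) := rfl
  rw [h1, PowerSeries.coeff_mul, PowerSeries.coeff_mul,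
    ← Finset.Nat.sum_antidiagonal_swap (f := fun p : ℕ × ℕ =>
      PowerSeries.coeff p.1 w * PowerSeries.coeff p.2 z), ← Finset.sum_sub_distrib]
  refine Submodule.sum_mem _ fun p hp => ?_
  rcases h p.1 p.2 (HasAntidiagonal.mem_antidiagonal.1 hp) with h | h | h
  · simp [h]
  · simp [h]
  · exact hW _ h.1 _ h.2

theorem psCoeff_commutator_pow_mem (hW : ∀ a ∈ W, ∀ b ∈ W, a * b - b * a ∈ W)
    {z w : MvPowerSeries Unit A} (hz : ∀ i, PowerSeries.coeff i z ∈ W)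
    (hw : ∀ i, PowerSeries.coeff i w ∈ W) (k i : ℕ) :
    PowerSeries.coeff i ((commutator K z ^ k) w) ∈ W := by
  induction k generalizing i with
  | zero => exact hw i
  | succ k ih =>
    rw [pow_succ', Module.End.mul_apply]
    exact psCoeff_commutator_mem hW fun i j _ => Or.inr (Or.inr ⟨hz i, ih j⟩)

/-- Neither series has a constant term, so the degree `n` part of a commutator involves only
components of degree below `n`. This gives the second claim, where at least one commutator is taken.
-/
theorem psCoeff_commutator_pow_mem_of_lt (hW : ∀ a ∈ W, ∀ b ∈ W, a * b - b * a ∈ W)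
    {z w : MvPowerSeries Unit A} (hz : z ∈ orderGE K 1) (hw : w ∈ orderGE K 1) {n : ℕ}
    (hzn : ∀ i < n, PowerSeries.coeff i z ∈ W) (hwn : ∀ i < n, PowerSeries.coeff i w ∈ W)
    (k : ℕ) : (∀ i < n, PowerSeries.coeff i ((commutator K z ^ k) w) ∈ W) ∧
      PowerSeries.coeff n ((commutator K z ^ (k + 1)) w) ∈ W := by
  have step : ∀ v : MvPowerSeries Unit A, v ∈ orderGE K 1 →
      (∀ i < n, PowerSeries.coeff i v ∈ W) →
      ∀ i ≤ n, PowerSeries.coeff i (commutator K z v) ∈ W := fun v hv hvn i hi =>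
    psCoeff_commutator_mem hW fun a b hab => by
      rcases Nat.eq_zero_or_pos a with rfl | ha
      · exact Or.inl (psCoeff_eq_zero hz zero_lt_one)
      · rcases Nat.eq_zero_or_pos b with rfl | hb
        · exact Or.inr (Or.inl (psCoeff_eq_zero hv zero_lt_one))
        · exact Or.inr (Or.inr ⟨hzn a (by omega), hvn b (by omega)⟩)
  have hmem : ∀ k, (commutator K z ^ k) w ∈ orderGE K 1 := fun k =>
    orderGE_anti (by omega) (commutator_pow_mem hz hw k)
  have hlt : ∀ k, ∀ i < n, PowerSeries.coeff i ((commutator K z ^ k) w) ∈ W := by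
    intro k
    induction k with
    | zero => exact hwn
    | succ k ih =>
      intro i hi
      rw [pow_succ', Module.End.mul_apply]
      exact step _ (hmem k) ih i hi.le
  refine ⟨hlt k, ?_⟩
  rw [pow_succ', Module.End.mul_apply]
  exact step _ (hmem k) (hlt k) n le_rfl

/-- The homogeneous components of the Hausdorff series of two elements of degree one lie in every
subspace that contains these elements and is closed under commutators. -/
theorem psCoeff_hausdorff_mem [CharZero K] (hW : ∀ a ∈ W, ∀ b ∈ W, a * b - b * a ∈ W) {a b : A} (ha : a ∈ W)
    (hb : b ∈ W) (n : ℕ) :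
    PowerSeries.coeff n (hausdorff K (PowerSeries.monomial 1 a : PowerSeries A)
      (PowerSeries.monomial 1 b : PowerSeries A)) ∈ W := by
  have hmon : ∀ a : A, (PowerSeries.monomial 1 a : PowerSeries A) ∈ orderGE (σ := Unit) K 1 :=
    fun a => mem_orderGE_one.2 (by
      have := PowerSeries.coeff_monomial 0 1 a
      rw [if_neg (by omega)] at this
      rwa [PowerSeries.coeff, Finsupp.single_zero] at this)
  have hD : ∀ a : A, euler K (PowerSeries.monomial 1 a : PowerSeries A) =
      (PowerSeries.monomial 1 a : PowerSeries A) := by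
    intro a
    refine PowerSeries.ext fun n => ?_
    rw [psCoeff_euler, PowerSeries.coeff_monomial]
    split_ifs with h <;> simp [h]
  have hc : ∀ a ∈ W, ∀ i, PowerSeries.coeff i (PowerSeries.monomial 1 a : PowerSeries A) ∈ W := by
    intro a ha i
    rw [PowerSeries.coeff_monomial]
    split_ifs
    · exact ha
    · exact W.zero_mem
  set z := hausdorff K (PowerSeries.monomial 1 a : PowerSeries A)
      (PowerSeries.monomial 1 b : PowerSeries A) with hz
  have hzm : z ∈ orderGE K 1 := hausdorff_mem (hmon a) (hmon b)
  have hode := locSum_commutator_hausdorff (hmon a) (hmon b) (hD a) (hD b)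
  rw [← hz] at hode
  induction n using Nat.strong_induction_on with
  | _ n ih =>
    have h1 := congrArg (fun f : MvPowerSeries Unit A => PowerSeries.coeff n f) hode
    have h2 : PowerSeries.coeff n ((PowerSeries.monomial 1 a : PowerSeries A) +
        locSum fun k => ((k.factorial : K)⁻¹) •
          (commutator K (PowerSeries.monomial 1 a : PowerSeries A) ^ k)
            (PowerSeries.monomial 1 b : PowerSeries A) : PowerSeries A) ∈ W := by
      rw [map_add]
      refine W.add_mem (hc a ha n) ?_
      rw [psCoeff_locSum]
      exact W.sum_mem fun k _ => W.smul_mem _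
        (psCoeff_commutator_pow_mem hW (hc a ha) (hc b hb) k n)
    -- In degree `n` of the differential equation the summand `k = 0` is `n z_n`; the other summands
    -- are in `W` by the induction hypothesis.
    have h3 : (n : K) • PowerSeries.coeff n z ∈ W := by
      rw [← psCoeff_euler]
      rw [psCoeff_locSum, Finset.sum_range_succ'] at h1
      have h4 : PowerSeries.coeff n ((((0 + 1).factorial : K)⁻¹) •
          (commutator K z ^ 0) (euler K z)) = PowerSeries.coeff n (euler K z) := by simp
      rw [h4] at h1
      rw [← sub_eq_of_eq_add' h1.symm]
      refine W.sub_mem h2 (W.sum_mem fun k _ => W.smul_mem _ ?_)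
      refine (psCoeff_commutator_pow_mem_of_lt hW hzm (euler_mem hzm) ih (fun i hi => ?_) k).2
      rw [psCoeff_euler]
      exact W.smul_mem _ (ih i hi)
    rcases Nat.eq_zero_or_pos n with rfl | hn
    · rw [psCoeff_eq_zero hzm zero_lt_one]
      exact W.zero_mem
    · have hn' : (n : K) ≠ 0 := by exact_mod_cast hn.ne'
      have := W.smul_mem (n : K)⁻¹ h3
      rwa [inv_smul_smul₀ hn'] at this

end LieSeriesProperty

section

variable (K : Type*) [Field K] [CharZero K]

attribute [local instance] LieRing.ofAssociativeRing

/-- The image of the free Lie algebra is closed under commutators and contains the generators, so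
the default `0` in `hausdorffLie` is never used. Which preimage is chosen does not matter:
`toU_lift` sees only its associative image. -/
theorem freeLieToAssoc_hausdorffLie (n : ℕ) :
    freeLieToAssoc K (hausdorffLie K n) = hausdorffAssoc K n := by
  have h : ∃ p, freeLieToAssoc K p = hausdorffAssoc K n := by
    have hι : ∀ i, FreeAlgebra.ι K i ∈ (freeLieToAssoc K).toLinearMap.range := fun i =>
      ⟨FreeLieAlgebra.of K i, FreeLieAlgebra.lift_of_apply _ i⟩
    refine LinearMap.mem_range.1
      (psCoeff_hausdorff_mem (W := (freeLieToAssoc K).toLinearMap.range) ?_ (hι 0) (hι 1) n)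
    rintro _ ⟨p, rfl⟩ _ ⟨q, rfl⟩
    exact ⟨⁅p, q⁆, LieHom.map_lie _ p q⟩
  rw [hausdorffLie, dif_pos h]
  exact h.choose_spec

end

end

end BHL

namespace BHL

noncomputable section

/-! ### Injectivity of the map from a Lie algebra to its universal enveloping algebra -/

section PBW

variable {K : Type*} [Field K] {g : Type*} [LieRing g] [LieAlgebra K g] {I : Type*}

/-- The span of the monomials of degree at most `n`. -/
abbrev degLE (K I : Type*) [Field K] (n : ℕ) : Submodule K (Multiset I →₀ K) :=
  Finsupp.supported K K {m | m.card ≤ n}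

theorem single_mem_degLE {n : ℕ} {m : Multiset I} (h : m.card ≤ n) :
    Finsupp.single m (1 : K) ∈ degLE K I n := Finsupp.single_mem_supported K 1 h

theorem degLE_mono {n k : ℕ} (h : n ≤ k) : degLE K I n ≤ degLE K I k :=
  Finsupp.supported_mono fun _ hm => le_trans hm h

theorem degLE_induction {n : ℕ} {V : Submodule K (Multiset I →₀ K)}
    (h : ∀ m : Multiset I, m.card ≤ n → Finsupp.single m (1 : K) ∈ V) : degLE K I n ≤ V := by
  rw [degLE, Finsupp.supported_eq_span_single, Submodule.span_le]
  rintro _ ⟨m, hm, rfl⟩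
  exact h m hm

variable [LinearOrder I] (b : Module.Basis I K g)

open Classical in
/-- An action of `g` on polynomials in the elements of an ordered basis, in which a basis element
not above the factors of a monomial multiplies it; it is correct on monomials of degree at most
`n`. -/
def pbwApprox : ℕ → g →ₗ[K] (Multiset I →₀ K) →ₗ[K] (Multiset I →₀ K)
  | 0 => b.constr K fun i => Finsupp.linearCombination K fun m => Finsupp.single (i ::ₘ m) 1
  | n + 1 => b.constr K fun i => Finsupp.linearCombination K fun m =>
      if m.card ≤ n then pbwApprox n (b i) (Finsupp.single m 1)
      else if h : ∃ j ∈ m, j < i ∧ ∀ k ∈ m, j ≤ k then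
        -- This value is forced by `b_i b_j N = b_j b_i N + [b_i, b_j] N` for `m = j ::ₘ N`, with
        -- `b_i N` split into its leading term `i ::ₘ N`, on which `b_j` just multiplies, and the
        -- rest.
        Finsupp.single (i ::ₘ m) 1 +
          pbwApprox n (b h.choose) (pbwApprox n (b i) (Finsupp.single (m.erase h.choose) 1) -
            Finsupp.single (i ::ₘ m.erase h.choose) 1) +
          pbwApprox n ⁅b i, b h.choose⁆ (Finsupp.single (m.erase h.choose) 1)
      else Finsupp.single (i ::ₘ m) 1

theorem pbwApprox_succ_of_le {n : ℕ} {m : Multiset I} (hm : m.card ≤ n) (i : I) :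
    pbwApprox b (n + 1) (b i) (Finsupp.single m 1) =
      pbwApprox b n (b i) (Finsupp.single m 1) := by
  rw [pbwApprox, Module.Basis.constr_basis, Finsupp.linearCombination_single, one_smul, if_pos hm]

theorem pbwApprox_of_forall_le {n : ℕ} {m : Multiset I} {i : I} (hi : ∀ k ∈ m, i ≤ k) :
    pbwApprox b n (b i) (Finsupp.single m 1) = Finsupp.single (i ::ₘ m) 1 := by
  induction n with
  | zero =>
    rw [pbwApprox, Module.Basis.constr_basis, Finsupp.linearCombination_single, one_smul]
  | succ n ih =>
    rw [pbwApprox, Module.Basis.constr_basis, Finsupp.linearCombination_single, one_smul, ih,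
      dif_neg, ite_self]
    rintro ⟨j, hj, hji, -⟩
    exact absurd (hi j hj) (not_le.2 hji)

theorem pbwApprox_cons {N : Multiset I} {i j : I} (hji : j < i) (hj : ∀ k ∈ N, j ≤ k) :
    pbwApprox b (N.card + 1) (b i) (Finsupp.single (j ::ₘ N) 1) =
      Finsupp.single (i ::ₘ j ::ₘ N) 1 +
        pbwApprox b N.card (b j) (pbwApprox b N.card (b i) (Finsupp.single N 1) -
          Finsupp.single (i ::ₘ N) 1) +
        pbwApprox b N.card ⁅b i, b j⁆ (Finsupp.single N 1) := by
  have hmin : ∀ k ∈ j ::ₘ N, j ≤ k := by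
    intro k hk
    rcases Multiset.mem_cons.1 hk with rfl | hk
    · exact le_rfl
    · exact hj k hk
  have h : ∃ l ∈ j ::ₘ N, l < i ∧ ∀ k ∈ j ::ₘ N, l ≤ k := ⟨j, Multiset.mem_cons_self j N, hji, hmin⟩
  -- A least factor is unique, so the choice in the definition must be `j`.
  have hc : h.choose = j :=
    le_antisymm (h.choose_spec.2.2 j (Multiset.mem_cons_self j N)) (hmin _ h.choose_spec.1)
  rw [pbwApprox, Module.Basis.constr_basis, Finsupp.linearCombination_single, one_smul,
    if_neg (by simp), dif_pos h, hc]
  have he : ∀ inst : DecidableEq I, @Multiset.erase I inst (j ::ₘ N) j = N := fun inst =>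
    Multiset.erase_cons_head j N
  rw [he]

theorem pbwApprox_succ {n : ℕ} (x : g) {v : Multiset I →₀ K} (hv : v ∈ degLE K I n) :
    pbwApprox b (n + 1) x v = pbwApprox b n x v := by
  have h : degLE K I n ≤ LinearMap.eqLocus (pbwApprox b (n + 1) x) (pbwApprox b n x) :=
    degLE_induction fun m hm => by
      rw [LinearMap.mem_eqLocus]
      have : (pbwApprox b (n + 1)).flip (Finsupp.single m 1) =
          (pbwApprox b n).flip (Finsupp.single m 1) :=
        b.ext fun i => pbwApprox_succ_of_le b hm i
      exact congrArg (fun f => f x) this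
  exact h hv

theorem pbwApprox_of_le {n k : ℕ} (hnk : n ≤ k) (x : g) {v : Multiset I →₀ K}
    (hv : v ∈ degLE K I n) : pbwApprox b k x v = pbwApprox b n x v := by
  induction k, hnk using Nat.le_induction with
  | base => rfl
  | succ k hk ih => rw [pbwApprox_succ b x (degLE_mono hk hv), ih]

/-- The action of `g` on polynomials in the elements of an ordered basis. -/
def pbwAction : g →ₗ[K] Module.End K (Multiset I →₀ K) :=
  b.constr K fun i => Finsupp.linearCombination K fun m =>
    pbwApprox b m.card (b i) (Finsupp.single m 1)

theorem pbwAction_basis (i : I) (m : Multiset I) :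
    pbwAction b (b i) (Finsupp.single m 1) = pbwApprox b m.card (b i) (Finsupp.single m 1) := by
  rw [pbwAction, Module.Basis.constr_basis, Finsupp.linearCombination_single, one_smul]

theorem pbwAction_eq_pbwApprox {n : ℕ} (x : g) {v : Multiset I →₀ K} (hv : v ∈ degLE K I n) :
    pbwAction b x v = pbwApprox b n x v := by
  have h : degLE K I n ≤ LinearMap.eqLocus (pbwAction b x) (pbwApprox b n x) :=
    degLE_induction fun m hm => by
      rw [LinearMap.mem_eqLocus]
      have : LinearMap.flip (pbwAction b) (Finsupp.single m 1) =
          (pbwApprox b n).flip (Finsupp.single m 1) :=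
        b.ext fun i => (pbwAction_basis b i m).trans
          (pbwApprox_of_le b hm (b i) (single_mem_degLE le_rfl)).symm
      exact congrArg (fun f => f x) this
  exact h hv

theorem pbwAction_of_forall_le {m : Multiset I} {i : I} (hi : ∀ k ∈ m, i ≤ k) :
    pbwAction b (b i) (Finsupp.single m 1) = Finsupp.single (i ::ₘ m) 1 := by
  rw [pbwAction_basis, pbwApprox_of_forall_le b hi]

omit [LinearOrder I] in
theorem basis_smul_mem {V : Submodule K (Multiset I →₀ K)}
    {ρ : g →ₗ[K] (Multiset I →₀ K) →ₗ[K] (Multiset I →₀ K)} {v : Multiset I →₀ K}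
    (h : ∀ i, ρ (b i) v ∈ V) (x : g) : ρ x v ∈ V := by
  have : LinearMap.range (ρ.flip v) ≤ V := by
    rw [LinearMap.range_eq_map, ← b.span_eq, Submodule.map_span_le]
    rintro _ ⟨i, rfl⟩
    exact h i
  exact this ⟨x, rfl⟩

/-- The action is multiplication by the basis element up to terms that do not raise the degree. This
lets the corrections be handled by induction on the degree. -/
theorem pbwAction_sub_mem (i : I) (m : Multiset I) :
    pbwAction b (b i) (Finsupp.single m 1) - Finsupp.single (i ::ₘ m) 1 ∈
      degLE K I m.card := by
  obtain ⟨n, hn⟩ : ∃ n, m.card = n := ⟨_, rfl⟩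
  induction n using Nat.strong_induction_on generalizing m i with
  | _ n ih =>
    have hup : ∀ k < n, ∀ x : g, ∀ v ∈ degLE K I k, pbwAction b x v ∈ degLE K I n := by
      intro k hk x v hv
      have : degLE K I k ≤ (degLE K I n).comap (pbwAction b x) := degLE_induction fun N hN =>
        basis_smul_mem (ρ := pbwAction b) b (fun l => by
          have h := ih N.card (by omega) l N rfl
          have h2 := Submodule.add_mem _ (degLE_mono (by omega : N.card ≤ n) h)
            (single_mem_degLE (K := K) (m := l ::ₘ N) (n := n) (by simp; omega))
          rwa [sub_add_cancel] at h2) x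
      exact this hv
    by_cases h : ∃ j ∈ m, j < i ∧ ∀ k ∈ m, j ≤ k
    · obtain ⟨j, hj, hji, hmin⟩ := h
      obtain ⟨N, rfl⟩ := Multiset.exists_cons_of_mem hj
      have hN : N.card < n := by rw [← hn, Multiset.card_cons]; omega
      have hj' : ∀ k ∈ N, j ≤ k := fun k hk => hmin k (Multiset.mem_cons_of_mem hk)
      have hw := ih N.card hN i N rfl
      rw [pbwAction_basis, Multiset.card_cons, pbwApprox_cons b hji hj', add_assoc,
        add_sub_cancel_left, ← pbwAction_eq_pbwApprox b (b i) (single_mem_degLE le_rfl),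
        ← pbwAction_eq_pbwApprox b (b j) hw,
        ← pbwAction_eq_pbwApprox b _ (single_mem_degLE le_rfl)]
      rw [Multiset.card_cons] at hn
      rw [hn]
      exact Submodule.add_mem _ (hup _ hN _ _ hw) (hup _ hN _ _ (single_mem_degLE le_rfl))
    · have hi : ∀ k ∈ m, i ≤ k := by
        intro k hk
        by_contra hki
        obtain ⟨j, hj, hjm⟩ := Finset.exists_min_image m.toFinset id ⟨k, by simpa using hk⟩
        simp only [Multiset.mem_toFinset, id] at hj hjm
        exact h ⟨j, hj, (hjm k hk).trans_lt (not_le.1 hki), hjm⟩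
      rw [pbwAction_of_forall_le b hi, sub_self]
      exact Submodule.zero_mem _

theorem pbwAction_cons {N : Multiset I} {i j : I} (hji : j < i) (hj : ∀ k ∈ N, j ≤ k) :
    pbwAction b (b i) (Finsupp.single (j ::ₘ N) 1) =
      pbwAction b (b j) (pbwAction b (b i) (Finsupp.single N 1)) +
        pbwAction b ⁅b i, b j⁆ (Finsupp.single N 1) := by
  have hji' : ∀ k ∈ i ::ₘ N, j ≤ k := by
    intro k hk
    rcases Multiset.mem_cons.1 hk with rfl | hk
    · exact hji.le
    · exact hj k hk
  rw [pbwAction_basis, Multiset.card_cons, pbwApprox_cons b hji hj,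
    ← pbwAction_eq_pbwApprox b (b i) (single_mem_degLE le_rfl),
    ← pbwAction_eq_pbwApprox b (b j) (pbwAction_sub_mem b i N),
    ← pbwAction_eq_pbwApprox b _ (single_mem_degLE le_rfl), map_sub,
    pbwAction_of_forall_le b hji', Multiset.cons_swap, add_sub_cancel]

/-- The compatibility of the action of `x` and `y` on `v` with the bracket. -/
def BracketRel (x y : g) (v : Multiset I →₀ K) : Prop :=
  pbwAction b x (pbwAction b y v) = pbwAction b y (pbwAction b x v) + pbwAction b ⁅x, y⁆ v

variable {b}

theorem BracketRel.symm {x y : g} {v : Multiset I →₀ K} (h : BracketRel b x y v) :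
    BracketRel b y x v := by
  rw [BracketRel] at h ⊢
  rw [h, ← lie_skew x y, map_neg, LinearMap.neg_apply, neg_add_cancel_right]

theorem BracketRel.refl (x : g) (v : Multiset I →₀ K) : BracketRel b x x v := by
  rw [BracketRel, lie_self, map_zero, LinearMap.zero_apply, add_zero]

theorem BracketRel.add {x y : g} {v w : Multiset I →₀ K} (h : BracketRel b x y v)
    (h' : BracketRel b x y w) : BracketRel b x y (v + w) := by
  rw [BracketRel] at h h' ⊢
  simp only [map_add, h, h']
  abel

theorem bracketRel_of_basis {v : Multiset I →₀ K} (h : ∀ i j, BracketRel b (b i) (b j) v)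
    (x y : g) : BracketRel b x y v := by
  let B : g →ₗ[K] g →ₗ[K] (Multiset I →₀ K) := LinearMap.mk₂ K
    (fun x y => pbwAction b x (pbwAction b y v) - (pbwAction b y (pbwAction b x v) +
      pbwAction b ⁅x, y⁆ v))
    (by intros; simp only [map_add, LinearMap.add_apply, add_lie]; abel)
    (by intros; simp only [map_smul, LinearMap.smul_apply, smul_lie, smul_sub, smul_add])
    (by intros; simp only [map_add, LinearMap.add_apply, lie_add]; abel)
    (by intros; simp only [map_smul, LinearMap.smul_apply, lie_smul, smul_sub, smul_add])
  have hB : B = 0 := b.ext fun i => b.ext fun j => by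
    simpa [B] using sub_eq_zero.2 (h i j)
  exact sub_eq_zero.1 (congrArg (fun f => f x y) hB)

theorem bracketRel_of_degLE {n : ℕ} {x y : g}
    (h : ∀ m : Multiset I, m.card ≤ n → BracketRel b x y (Finsupp.single m 1))
    {v : Multiset I →₀ K} (hv : v ∈ degLE K I n) : BracketRel b x y v := by
  have : degLE K I n ≤ LinearMap.eqLocus (pbwAction b x * pbwAction b y)
      (pbwAction b y * pbwAction b x + pbwAction b ⁅x, y⁆) := degLE_induction h
  exact this hv

/-- For `j < i` the relation was built into the action; for `i < j` the index `i` is also below all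
factors, and the relation is symmetric. -/
theorem bracketRel_of_forall_le {m : Multiset I} {i j : I} (hj : ∀ k ∈ m, j ≤ k) :
    BracketRel b (b i) (b j) (Finsupp.single m 1) := by
  have key : ∀ {i j : I}, (∀ k ∈ m, j ≤ k) → j < i →
      BracketRel b (b i) (b j) (Finsupp.single m 1) := fun hj hji => by
    rw [BracketRel, pbwAction_of_forall_le b hj, pbwAction_cons b hji hj]
  rcases lt_trichotomy i j with h | rfl | h
  · exact (key (fun k hk => h.le.trans (hj k hk)) h).symm
  · exact BracketRel.refl _ _
  · exact key hj h

/-- Induction on the degree. If neither `i` nor `j` is below all factors, write `m = k ::ₘ N` with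
`k` least, so `k < i` and `k < j`. Then `m = b_k N`, and moving `b_k` to the left past `b_i` and
`b_j` reduces the claim to relations on `N` and the Jacobi identity. -/
theorem bracketRel (x y : g) (m : Multiset I) : BracketRel b x y (Finsupp.single m 1) := by
  obtain ⟨n, hn⟩ : ∃ n, m.card = n := ⟨_, rfl⟩
  induction n using Nat.strong_induction_on generalizing m x y with
  | _ n ih =>
    refine bracketRel_of_basis (fun i j => ?_) x y
    by_cases hj : ∀ k ∈ m, j ≤ k
    · exact bracketRel_of_forall_le hj
    by_cases hi : ∀ k ∈ m, i ≤ k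
    · exact (bracketRel_of_forall_le hi).symm
    push Not at hi hj
    obtain ⟨k₁, hk₁, hjk⟩ := hj
    obtain ⟨k₂, hk₂, hik⟩ := hi
    obtain ⟨k, hk, hkm⟩ := Finset.exists_min_image m.toFinset id ⟨k₁, by simpa using hk₁⟩
    simp only [Multiset.mem_toFinset, id] at hk hkm
    replace hjk := (hkm k₁ hk₁).trans_lt hjk
    replace hik := (hkm k₂ hk₂).trans_lt hik
    obtain ⟨N, rfl⟩ := Multiset.exists_cons_of_mem hk
    have hkN : ∀ l ∈ N, k ≤ l := fun l hl => hkm l (Multiset.mem_cons_of_mem hl)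
    have hN : N.card < n := by rw [← hn, Multiset.card_cons]; omega
    have hlow : ∀ x y : g, ∀ v ∈ degLE K I N.card, BracketRel b x y v := fun x y v hv =>
      bracketRel_of_degLE (fun m hm => ih m.card (by omega) x y m rfl) hv
    -- `b_j' N` is `j' ::ₘ N`, on which `k` is below all factors, plus a part of degree at most
    -- `|N|` covered by induction.
    have hmid : ∀ i' j' : I, k < j' →
        BracketRel b (b i') (b k) (pbwAction b (b j') (Finsupp.single N 1)) := fun i' j' h => by
      rw [← sub_add_cancel (pbwAction b (b j') (Finsupp.single N 1))
        (Finsupp.single (j' ::ₘ N) 1)]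
      refine (hlow _ _ _ (pbwAction_sub_mem b j' N)).add (bracketRel_of_forall_le ?_)
      intro l hl
      rcases Multiset.mem_cons.1 hl with rfl | hl
      · exact h.le
      · exact hkN l hl
    have hz := single_mem_degLE (K := K) (le_refl N.card)
    have e1 := hmid i j hjk
    have e2 := hmid j i hik
    have e3 := hlow (b i) ⁅b j, b k⁆ _ hz
    have e4 := hlow (b j) ⁅b i, b k⁆ _ hz
    have e5 := hlow (⁅b i, b j⁆) (b k) _ hz
    have e6 := hlow (b i) (b j) _ hz
    have jac : pbwAction b ⁅⁅b i, b j⁆, b k⁆ (Finsupp.single N 1) =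
        pbwAction b ⁅b i, ⁅b j, b k⁆⁆ (Finsupp.single N 1) -
          pbwAction b ⁅b j, ⁅b i, b k⁆⁆ (Finsupp.single N 1) := by
      rw [lie_lie, map_sub, LinearMap.sub_apply]
    have hkz : pbwAction b (b k) (Finsupp.single N 1) = Finsupp.single (k ::ₘ N) 1 :=
      pbwAction_of_forall_le b hkN
    rw [BracketRel] at e1 e2 e3 e4 e5 e6 ⊢
    rw [pbwAction_cons b hjk hkN, pbwAction_cons b hik hkN, map_add, map_add, e1, e2, e3, e4, e6,
      ← hkz, e5, jac, map_add]
    abel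

attribute [local instance] LieRing.ofAssociativeRing

/-- The action on polynomials extends to the enveloping algebra. Applying `x` to the empty monomial
returns the coordinates of `x` as a linear polynomial, so `ι x = 0` forces `x = 0`. -/
theorem universalEnveloping_ι_injective (K : Type*) [Field K] (g : Type*) [LieRing g]
    [LieAlgebra K g] : Function.Injective (UniversalEnvelopingAlgebra.ι K : g → _) := by
  let I := Module.Basis.ofVectorSpaceIndex K g
  let b : Module.Basis I K g := Module.Basis.ofVectorSpace K g
  -- Any linear order on the basis will do; well-foundedness is discarded.
  obtain ⟨_, -⟩ := exists_wellFoundedLT I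
  let ρ : g →ₗ⁅K⁆ Module.End K (Multiset I →₀ K) :=
    { pbwAction b with
      map_lie' := fun {x y} => by
        refine Finsupp.lhom_ext' fun m => LinearMap.ext_ring ?_
        exact (sub_eq_of_eq_add' (bracketRel (b := b) x y m)).symm }
  refine (injective_iff_map_eq_zero (UniversalEnvelopingAlgebra.ι K : g →ₗ⁅K⁆ _)).2 fun x hx => ?_
  have h1 : ρ x = 0 := by
    rw [← UniversalEnvelopingAlgebra.lift_ι_apply K ρ x, hx, map_zero]
  have h2 : ∀ x : g, pbwAction b x (Finsupp.single 0 1) =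
      Finsupp.mapDomain (fun i => ({i} : Multiset I)) (b.repr x) := by
    have : LinearMap.flip (pbwAction b) (Finsupp.single 0 1) =
        Finsupp.lmapDomain K K (fun i => ({i} : Multiset I)) ∘ₗ b.repr.toLinearMap :=
      b.ext fun i => by
        simpa using pbwAction_of_forall_le b (m := 0) (i := i) (by simp)
    exact fun x => congrArg (fun f => f x) this
  have h3 : Finsupp.mapDomain (fun i => ({i} : Multiset I)) (b.repr x) = 0 := by
    rw [← h2]
    exact congrArg (fun f : Module.End K (Multiset I →₀ K) => f (Finsupp.single 0 1)) h1
  have h4 := Finsupp.mapDomain_injective (fun _ _ h => Multiset.singleton_inj.1 h)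
    (h3.trans Finsupp.mapDomain_zero.symm)
  exact b.repr.map_eq_zero_iff.1 h4

end PBW

end

end BHL

namespace BHL

noncomputable section

namespace LieSeries

/-! ### The Hausdorff series in `g[[s,t]]` -/

section Embedding

attribute [local instance] LieRing.ofAssociativeRing

variable (K : Type*) [Field K] {g : Type*} [LieRing g] [LieAlgebra K g]

/-- The coefficientwise embedding of `g[[s,t]]` into `U(g)[[s,t]]`, as a linear map. -/
def toULinear : LieSeries g →ₗ[K] MvPowerSeries (Fin 2) (UniversalEnvelopingAlgebra K g) where
  toFun x := fun d => UniversalEnvelopingAlgebra.ι K (x d)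
  map_add' x y := by
    funext d
    exact map_add (UniversalEnvelopingAlgebra.ι K) (x d) (y d)
  map_smul' c x := by
    funext d
    exact map_smul (UniversalEnvelopingAlgebra.ι K) c (x d)

theorem coeff_toULinear (x : LieSeries g) (d : Fin 2 →₀ ℕ) :
    MvPowerSeries.coeff d (toULinear K x) = UniversalEnvelopingAlgebra.ι K (x d) := rfl

theorem toULinear_lie (x y : LieSeries g) :
    toULinear K ⁅x, y⁆ = toULinear K x * toULinear K y - toULinear K y * toULinear K x := by
  classical
  refine MvPowerSeries.ext fun d => ?_
  rw [map_sub, MvPowerSeries.coeff_mul, MvPowerSeries.coeff_mul, coeff_toULinear, bracket_apply,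
    map_sum]
  simp only [coeff_toULinear, LieHom.map_lie, LieRing.of_associative_ring_bracket,
    Finset.sum_sub_distrib]
  congr 1
  refine Finset.sum_nbij' Prod.swap Prod.swap ?_ ?_ ?_ ?_ ?_ <;> simp +contextual [add_comm]

/-- The coefficientwise embedding of `g[[s,t]]` into `U(g)[[s,t]]`. -/
def toU : LieSeries g →ₗ⁅K⁆ MvPowerSeries (Fin 2) (UniversalEnvelopingAlgebra K g) :=
  { toULinear K with map_lie' := fun {x y} => toULinear_lie K x y }

variable {K}

theorem coeff_toU (x : LieSeries g) (d : Fin 2 →₀ ℕ) :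
    MvPowerSeries.coeff d (toU K x) = UniversalEnvelopingAlgebra.ι K (x d) := rfl

theorem exp_eq (x : LieSeries g) : LieSeries.exp K x = formalExp K (toU K x) := rfl

theorem sub_apply (x y : LieSeries g) (d : Fin 2 →₀ ℕ) : (x - y) d = x d - y d := rfl

theorem ι_eq_zero {a : g} : UniversalEnvelopingAlgebra.ι K a = 0 ↔ a = 0 :=
  map_eq_zero_iff _ (universalEnveloping_ι_injective K g)

theorem toU_injective : Function.Injective (toU K : LieSeries g → _) := fun x y h => by
  funext d
  exact universalEnveloping_ι_injective K g
    (congrArg (fun f => MvPowerSeries.coeff d f) h)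

theorem toU_mem_orderGE {x : LieSeries g} {n : ℕ} :
    toU K x ∈ orderGE K n ↔ x ∈ filtration K n :=
  forall₂_congr fun d _ => by rw [coeff_toU, ι_eq_zero]

theorem toU_lift (x y : LieSeries g) (p : FreeLieAlgebra K (Fin 2)) :
    toU K (FreeLieAlgebra.lift K ![x, y] p) =
      FreeAlgebra.lift K ![toU K x, toU K y] (freeLieToAssoc K p) := by
  have h : (toU K).comp (FreeLieAlgebra.lift K ![x, y]) =
      (FreeAlgebra.lift K ![toU K x, toU K y]).toLieHom.comp (freeLieToAssoc K) := by
    refine FreeLieAlgebra.hom_ext fun i => ?_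
    rw [LieHom.comp_apply, LieHom.comp_apply, FreeLieAlgebra.lift_of_apply, freeLieToAssoc,
      FreeLieAlgebra.lift_of_apply]
    refine Eq.trans ?_ (FreeAlgebra.lift_ι_apply ![toU K x, toU K y] i).symm
    fin_cases i <;> rfl
  exact congrArg (fun f => f p) h

end Embedding

/-! ### Limits in the filtration topology -/

section Limits

variable {K : Type*} [Field K] {g : Type*} [LieRing g] [LieAlgebra K g]

theorem filtration_anti {m n : ℕ} (h : m ≤ n) {x : LieSeries g} (hx : x ∈ filtration K n) :
    x ∈ filtration K m := fun d hd => hx d (hd.trans_le h)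

theorem mem_filtration_zero (x : LieSeries g) : x ∈ filtration K 0 :=
  fun _ h => absurd h (by simp)

theorem eq_of_sub_mem_filtration {x y : LieSeries g} (h : ∀ n, x - y ∈ filtration K n) :
    x = y := by
  funext d
  exact sub_eq_zero.1 (h (d.degree + 1) d (by omega))

theorem isFiltLim_unique {u : ℕ → LieSeries g} {l l' : LieSeries g}
    (h : IsFiltLim (filtration K) u l) (h' : IsFiltLim (filtration K) u l') : l = l' :=
  eq_of_sub_mem_filtration (K := K) fun N => by
    obtain ⟨M, hM⟩ := h N
    obtain ⟨M', hM'⟩ := h' N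
    have := Submodule.sub_mem _ (hM' (max M M') (le_max_right _ _))
      (hM (max M M') (le_max_left _ _))
    rwa [sub_sub_sub_cancel_left] at this

theorem filtLim_eq {u : ℕ → LieSeries g} {l : LieSeries g}
    (h : IsFiltLim (filtration K) u l) : filtLim (filtration K) u = l := by
  have hex : ∃ l, IsFiltLim (filtration K) u l := ⟨l, h⟩
  rw [filtLim, dif_pos hex]
  exact isFiltLim_unique hex.choose_spec h

theorem exists_limit {u : ℕ → LieSeries g} (hu : ∀ n, u (n + 1) - u n ∈ filtration K n) :
    ∃ l, ∀ n, u n - l ∈ filtration K n := by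
  have hstab : ∀ k m, u (k + m) - u k ∈ filtration K k := by
    intro k m
    induction m with
    | zero => simp
    | succ m ih =>
      have := Submodule.add_mem _ (filtration_anti (by omega) (hu (k + m))) ih
      rwa [sub_add_sub_cancel] at this
  -- The coefficient at `d` no longer changes from index `d.degree + 1` on.
  refine ⟨fun d => u (d.degree + 1) d, fun n d hd => ?_⟩
  obtain ⟨m, rfl⟩ : ∃ m, n = d.degree + 1 + m := ⟨n - (d.degree + 1), by omega⟩
  exact hstab (d.degree + 1) m d (by omega)

theorem isFiltLim_of_sub_mem {u : ℕ → LieSeries g} {l : LieSeries g}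
    (h : ∀ n, u n - l ∈ filtration K n) : IsFiltLim (filtration K) u l :=
  fun N => ⟨N, fun n hn => filtration_anti hn (h n)⟩

end Limits

/-! ### `C` and `BCH` on series without constant term -/

section Hausdorff

attribute [local instance] LieRing.ofAssociativeRing

variable {K : Type*} [Field K] [CharZero K] {g : Type*} [LieRing g] [LieAlgebra K g]
  {x y x' y' : LieSeries g}

theorem toU_lift_hausdorffLie (hx : x ∈ filtration K 1) (hy : y ∈ filtration K 1) :
    (∀ k, toU K (FreeLieAlgebra.lift K ![x, y] (hausdorffLie K k)) ∈ orderGE K k) ∧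
      (locSum fun k => toU K (FreeLieAlgebra.lift K ![x, y] (hausdorffLie K k))) =
        hausdorff K (toU K x) (toU K y) := by
  set ψ := FreeAlgebra.lift K ![toU K x, toU K y] with hψ
  -- The same substitution homomorphism in every degree. Convergence comes from `toU x` and `toU y`
  -- having order at least one, so that degree `k` is sent to order at least `k`.
  let φ : ℕ → FreeAlgebra K (Fin 2) →ₗ[K]
    MvPowerSeries (Fin 2) (UniversalEnvelopingAlgebra K g) := fun _ => ψ.toLinearMap
  have hφ : IsGradedHom φ := ⟨map_one ψ, fun _ _ => map_mul ψ⟩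
  let m : Fin 2 → MvPowerSeries Unit (FreeAlgebra K (Fin 2)) := fun i =>
    PowerSeries.monomial 1 (FreeAlgebra.ι K i)
  have hxy : ∀ i, ψ (FreeAlgebra.ι K i) = ![toU K x, toU K y] i := fun i =>
    FreeAlgebra.lift_ι_apply _ i
  have hmem : ∀ i, ψ (FreeAlgebra.ι K i) ∈ orderGE K 1 := fun i => by
    rw [hxy]
    fin_cases i
    · exact toU_mem_orderGE.2 hx
    · exact toU_mem_orderGE.2 hy
  have hc : ∀ i k, φ k (PowerSeries.coeff k (m i)) =
      if k = 1 then ψ (FreeAlgebra.ι K i) else 0 := by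
    intro i k
    change ψ (PowerSeries.coeff k (PowerSeries.monomial 1 (FreeAlgebra.ι K i))) = _
    rw [PowerSeries.coeff_monomial, apply_ite ψ, map_zero]
  have hev : ∀ i, IsEvaluable φ (m i) := fun i k => by
    rw [hc]
    split_ifs with h
    · exact h ▸ hmem i
    · exact Submodule.zero_mem _
  have hm1 : ∀ i, m i ∈ orderGE K 1 := fun i => mem_orderGE_one.2 (by
    have := PowerSeries.coeff_monomial 0 1 (FreeAlgebra.ι K i)
    rw [if_neg (by omega)] at this
    rwa [PowerSeries.coeff, Finsupp.single_zero] at this)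
  have hval : ∀ i, gradedEval φ (m i) = ![toU K x, toU K y] i := fun i => by
    rw [gradedEval, locSum_eq_add (hev i), locSum_eq_add (K := K)
      fun k => orderGE_anti k.le_succ (hev i (k + 1))]
    simp only [hc, hxy]
    simp [locSum_zero]
  have hexp : ∀ i, IsEvaluable φ (formalExp K (m i)) := fun i => by
    rw [formalExp_eq_powSum]
    exact (hev i).powSum hφ _
  have hprod := (hexp 0).mul hφ (hexp 1)
  have hsub := hprod.sub (IsEvaluable.one (φ := φ))
  have hH : IsEvaluable φ (hausdorff K (m 0) (m 1)) := by
    rw [hausdorff, formalLog_eq_powSum]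
    exact hsub.powSum hφ _
  have key : ∀ k, toU K (FreeLieAlgebra.lift K ![x, y] (hausdorffLie K k)) =
      φ k (PowerSeries.coeff k (hausdorff K (m 0) (m 1))) := fun k => by
    rw [toU_lift, freeLieToAssoc_hausdorffLie]
    rfl
  simp only [key]
  refine ⟨hH, ?_⟩
  change gradedEval φ (hausdorff K (m 0) (m 1)) = _
  rw [hausdorff, formalLog_eq_powSum,
    gradedEval_powSum hφ _ hsub (formalExp_mul_sub_one_mem (hm1 0) (hm1 1)), gradedEval_sub,
    gradedEval_one hφ, gradedEval_mul hφ (hexp 0) (hexp 1), formalExp_eq_powSum,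
    formalExp_eq_powSum, gradedEval_powSum hφ _ (hev 0) (hm1 0),
    gradedEval_powSum hφ _ (hev 1) (hm1 1), hval, hval, ← formalExp_eq_powSum,
    ← formalExp_eq_powSum, ← formalLog_eq_powSum]
  rfl

theorem exists_hausdorffSum_limit (hx : x ∈ filtration K 1) (hy : y ∈ filtration K 1) :
    ∃ l, IsFiltLim (filtration K) (hausdorffSum K x y) l ∧
      toU K l = hausdorff K (toU K x) (toU K y) := by
  obtain ⟨h1, h2⟩ := toU_lift_hausdorffLie hx hy
  obtain ⟨l, hl⟩ := exists_limit (K := K) (u := hausdorffSum K x y) (fun n => by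
    rw [hausdorffSum, Finset.sum_range_succ, ← hausdorffSum, add_sub_cancel_left]
    exact toU_mem_orderGE.1 (h1 n))
  refine ⟨l, isFiltLim_of_sub_mem hl, ?_⟩
  refine eq_of_sub_mem_orderGE (K := K) fun n => ?_
  have h3 := toU_mem_orderGE.2 (hl n)
  have h4 : toU K (hausdorffSum K x y n) - hausdorff K (toU K x) (toU K y) ∈ orderGE K n := by
    intro d hd
    rw [map_sub, ← h2, coeff_locSum_of_lt h1 hd, hausdorffSum, map_sum, map_sum, sub_self]
  have h5 := Submodule.sub_mem _ h4 h3
  rwa [map_sub, sub_sub_sub_cancel_left] at h5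

theorem isFiltLim_C (hx : x ∈ filtration K 1) (hy : y ∈ filtration K 1) :
    IsFiltLim (filtration K) (hausdorffSum K x y) (BHL.C (filtration K) x y) := by
  obtain ⟨l, hl, -⟩ := exists_hausdorffSum_limit hx hy
  rwa [BHL.C, filtLim_eq hl]

theorem toU_C (hx : x ∈ filtration K 1) (hy : y ∈ filtration K 1) :
    toU K (BHL.C (filtration K) x y) = hausdorff K (toU K x) (toU K y) := by
  obtain ⟨l, hl, h⟩ := exists_hausdorffSum_limit hx hy
  rwa [BHL.C, filtLim_eq hl]

theorem C_mem (hx : x ∈ filtration K 1) (hy : y ∈ filtration K 1) :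
    BHL.C (filtration K) x y ∈ filtration K 1 := by
  rw [← toU_mem_orderGE, toU_C hx hy]
  exact hausdorff_mem (toU_mem_orderGE.2 hx) (toU_mem_orderGE.2 hy)

theorem exp_C (hx : x ∈ filtration K 1) (hy : y ∈ filtration K 1) :
    LieSeries.exp K (BHL.C (filtration K) x y) = LieSeries.exp K x * LieSeries.exp K y := by
  rw [exp_eq, toU_C hx hy,
    formalExp_hausdorff (toU_mem_orderGE.2 hx) (toU_mem_orderGE.2 hy), exp_eq, exp_eq]

omit [CharZero K] in
theorem exp_injOn (hx : x ∈ filtration K 1) (hy : y ∈ filtration K 1)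
    (h : LieSeries.exp K x = LieSeries.exp K y) : x = y :=
  toU_injective (formalExp_injOn (toU_mem_orderGE.2 hx) (toU_mem_orderGE.2 hy) h)

theorem toU_BCH (hx : x ∈ filtration K 1) (hy : y ∈ filtration K 1) :
    toU K (BCH (filtration K) x y) = hausdorff K (toU K x) (toU K y) - toU K x - toU K y := by
  rw [BCH, map_sub, map_sub, toU_C hx hy]

theorem BCH_mem (hx : x ∈ filtration K 1) (hy : y ∈ filtration K 1) :
    BCH (filtration K) x y ∈ filtration K 1 :=
  Submodule.sub_mem _ (Submodule.sub_mem _ (C_mem hx hy) hx) hy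

theorem BCH_sub_mem (hx : x ∈ filtration K 1) (hy : y ∈ filtration K 1)
    (hx' : x' ∈ filtration K 1) (hy' : y' ∈ filtration K 1) {n : ℕ}
    (hxx : x - x' ∈ filtration K n) (hyy : y - y' ∈ filtration K n) :
    BCH (filtration K) x y - BCH (filtration K) x' y' ∈ filtration K (n + 1) := by
  rw [← toU_mem_orderGE, map_sub] at hxx hyy ⊢
  rw [toU_BCH hx hy, toU_BCH hx' hy']
  exact hausdorff_sub_mem (toU_mem_orderGE.2 hx) (toU_mem_orderGE.2 hy) (toU_mem_orderGE.2 hx')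
    (toU_mem_orderGE.2 hy') hxx hyy

/-- Setting the variable `i` to zero is multiplicative and kills `x`, leaving `C(0, y) = y`. -/
theorem BCH_apply_eq_zero_of_left (hx : x ∈ filtration K 1) (hy : y ∈ filtration K 1) {i : Fin 2}
    (h : ∀ d : Fin 2 →₀ ℕ, d i = 0 → x d = 0) {d : Fin 2 →₀ ℕ} (hd : d i = 0) :
    BCH (filtration K) x y d = 0 := by
  have h0 : zeroVar i (toU K x) = 0 := by
    ext e
    rw [coeff_zeroVar]
    split_ifs with he
    · rw [coeff_toU, h e he, map_zero, map_zero]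
    · rw [map_zero]
  have h1 := congrArg (MvPowerSeries.coeff d)
    (zeroVar_hausdorff_of_left i (toU_mem_orderGE.2 hy) h0)
  rw [coeff_zeroVar, coeff_zeroVar, if_pos hd, if_pos hd] at h1
  rw [← ι_eq_zero (K := K), ← coeff_toU, toU_BCH hx hy, map_sub, map_sub, h1, coeff_toU x,
    h d hd, map_zero, sub_zero, sub_self]

theorem BCH_apply_eq_zero_of_right (hx : x ∈ filtration K 1) (hy : y ∈ filtration K 1) {i : Fin 2}
    (h : ∀ d : Fin 2 →₀ ℕ, d i = 0 → y d = 0) {d : Fin 2 →₀ ℕ} (hd : d i = 0) :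
    BCH (filtration K) x y d = 0 := by
  have h0 : zeroVar i (toU K y) = 0 := by
    ext e
    rw [coeff_zeroVar]
    split_ifs with he
    · rw [coeff_toU, h e he, map_zero, map_zero]
    · rw [map_zero]
  have h1 := congrArg (MvPowerSeries.coeff d)
    (zeroVar_hausdorff_of_right i (toU_mem_orderGE.2 hx) h0)
  rw [coeff_zeroVar, coeff_zeroVar, if_pos hd, if_pos hd] at h1
  rw [← ι_eq_zero (K := K), ← coeff_toU, toU_BCH hx hy, map_sub, map_sub, h1, coeff_toU y,
    h d hd, map_zero, sub_zero, sub_self]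

end Hausdorff

end LieSeries

end

end BHL

namespace BHL

noncomputable section

namespace LieSeries

/-! ### The recursion map and the factorization for a splitting -/

section Splitting

variable {K : Type*} [Field K] {g : Type*} [LieRing g] [LieAlgebra K g]

/-- The linear map `P` respects the filtration. -/
def IsFiltered (P : LieSeries g →ₗ[K] LieSeries g) : Prop :=
  ∀ n, ∀ x ∈ filtration K n, P x ∈ filtration K n

theorem compl_apply (P : LieSeries g →ₗ[K] LieSeries g) (x : LieSeries g) :
    compl P x = x - P x := rfl

theorem compl_compl (P : LieSeries g →ₗ[K] LieSeries g) : compl (compl P) = P :=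
  LinearMap.ext fun x => by rw [compl_apply, compl_apply, sub_sub_cancel]

theorem IsFiltered.compl {P : LieSeries g →ₗ[K] LieSeries g} (h : IsFiltered P) :
    IsFiltered (compl P) := fun n x hx => Submodule.sub_mem _ hx (h n x hx)

/-- `C(P(c), P̃(c))`. -/
def splitC (P : LieSeries g →ₗ[K] LieSeries g) (c : LieSeries g) : LieSeries g :=
  BHL.C (filtration K) (P c) (compl P c)

theorem splitC_eq (P : LieSeries g →ₗ[K] LieSeries g) (c : LieSeries g) :
    splitC P c = c + BCH (filtration K) (P c) (compl P c) := by
  rw [splitC, BCH, compl_apply]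
  abel

variable [CharZero K] {P : LieSeries g →ₗ[K] LieSeries g}

theorem splitBCH_mem (hP : IsFiltered P) {c : LieSeries g} (hc : c ∈ filtration K 1) :
    BCH (filtration K) (P c) (compl P c) ∈ filtration K 1 :=
  BCH_mem (hP 1 c hc) (hP.compl 1 c hc)

theorem splitBCH_sub_mem (hP : IsFiltered P) {c c' : LieSeries g} (hc : c ∈ filtration K 1)
    (hc' : c' ∈ filtration K 1) {n : ℕ} (h : c - c' ∈ filtration K n) :
    BCH (filtration K) (P c) (compl P c) - BCH (filtration K) (P c') (compl P c') ∈
      filtration K (n + 1) :=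
  BCH_sub_mem (hP 1 c hc) (hP.compl 1 c hc) (hP 1 c' hc') (hP.compl 1 c' hc')
    (by rw [← map_sub]; exact hP n _ h) (by rw [← map_sub]; exact hP.compl n _ h)

theorem splitC_injOn (hP : IsFiltered P) : Set.InjOn (splitC P) (filtration K 1 : Submodule K (LieSeries g)) := by
  intro c hc c' hc' h
  refine eq_of_sub_mem_filtration (K := K) fun n => ?_
  induction n with
  | zero => exact mem_filtration_zero _
  | succ n ih =>
    have h2 := splitBCH_sub_mem hP hc hc' ih
    rw [splitC_eq, splitC_eq] at h
    have h3 : c - c' = -(BCH (filtration K) (P c) (compl P c) -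
        BCH (filtration K) (P c') (compl P c')) := by
      rw [neg_sub, sub_eq_sub_iff_add_eq_add, h, add_comm]
    rw [h3]
    exact Submodule.neg_mem _ h2

theorem chiSeq_mem (hP : IsFiltered P) {a : LieSeries g} (ha : a ∈ filtration K 1) (n : ℕ) :
    chiSeq (filtration K) P a n ∈ filtration K 1 := by
  induction n with
  | zero => exact ha
  | succ n ih => exact Submodule.sub_mem _ ha (splitBCH_mem hP ih)

/-- The fixed point argument: successive iterates differ by a term whose order grows by one at each
step, and the limit solves `c + BCH(P c, P̃ c) = a`. -/
theorem exists_chiSeq_limit (hP : IsFiltered P) {a : LieSeries g} (ha : a ∈ filtration K 1) :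
    ∃ l, IsFiltLim (filtration K) (chiSeq (filtration K) P a) l ∧ l ∈ filtration K 1 ∧
      splitC P l = a := by
  have hmem := chiSeq_mem hP ha
  obtain ⟨l, hl⟩ := exists_limit (K := K) (u := chiSeq (filtration K) P a) (fun n => by
    induction n with
    | zero => exact mem_filtration_zero _
    | succ n ih =>
      have h := splitBCH_sub_mem hP (hmem (n + 1)) (hmem n) ih
      rw [chiSeq, chiSeq, sub_sub_sub_cancel_left, ← neg_sub]
      exact Submodule.neg_mem _ h)
  have hl1 : l ∈ filtration K 1 := by
    have := Submodule.sub_mem _ (hmem 1) (hl 1)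
    rwa [sub_sub_cancel] at this
  refine ⟨l, isFiltLim_of_sub_mem hl, hl1, eq_of_sub_mem_filtration (K := K) fun n => ?_⟩
  have h1 := splitBCH_sub_mem hP (hmem n) hl1 (hl n)
  have h2 := hl (n + 1)
  rw [chiSeq] at h2
  have h3 := Submodule.neg_mem _ (Submodule.add_mem _ h1 h2)
  rw [splitC_eq]
  refine filtration_anti n.le_succ ?_
  convert h3 using 1
  abel

theorem isFiltLim_chi (hP : IsFiltered P) {a : LieSeries g} (ha : a ∈ filtration K 1) :
    IsFiltLim (filtration K) (chiSeq (filtration K) P a) (chi (filtration K) P a) := by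
  obtain ⟨l, hl, -⟩ := exists_chiSeq_limit hP ha
  rwa [chi, filtLim_eq hl]

theorem chi_mem (hP : IsFiltered P) {a : LieSeries g} (ha : a ∈ filtration K 1) :
    chi (filtration K) P a ∈ filtration K 1 := by
  obtain ⟨l, hl, h, -⟩ := exists_chiSeq_limit hP ha
  rwa [chi, filtLim_eq hl]

theorem splitC_chi (hP : IsFiltered P) {a : LieSeries g} (ha : a ∈ filtration K 1) :
    splitC P (chi (filtration K) P a) = a := by
  obtain ⟨l, hl, -, h⟩ := exists_chiSeq_limit hP ha
  rwa [chi, filtLim_eq hl]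

/-- A subspace `S` of `g[[s,t]]₁` which is closed, is split by `P` as `Sm ⊕ Sp` and is stable
under `c ↦ BCH(P(c), P̃(c))`. -/
structure IsSplitting (P : LieSeries g →ₗ[K] LieSeries g)
    (S Sm Sp : Submodule K (LieSeries g)) : Prop where
  isFiltered : IsFiltered P
  le : S ≤ filtration K 1
  add_mem : ∀ u ∈ Sm, ∀ w ∈ Sp, u + w ∈ S
  map_add : ∀ u ∈ Sm, ∀ w ∈ Sp, P (u + w) = u
  map_mem : ∀ c ∈ S, P c ∈ Sm
  compl_mem : ∀ c ∈ S, compl P c ∈ Sp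
  bch_mem : ∀ c ∈ S, BCH (filtration K) (P c) (compl P c) ∈ S
  lim_mem : ∀ (u : ℕ → LieSeries g) (l : LieSeries g), IsFiltLim (filtration K) u l →
    (∀ n, u n ∈ S) → l ∈ S

namespace IsSplitting

variable {S Sm Sp : Submodule K (LieSeries g)} (h : IsSplitting P S Sm Sp)

omit [CharZero K]

include h

theorem compl_map_add {u w : LieSeries g} (hu : u ∈ Sm) (hw : w ∈ Sp) : compl P (u + w) = w := by
  rw [compl_apply, h.map_add u hu w hw, add_sub_cancel_left]

theorem left_le : Sm ≤ S := fun u hu => by simpa using h.add_mem u hu 0 Sp.zero_mem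

theorem right_le : Sp ≤ S := fun w hw => by simpa using h.add_mem 0 Sm.zero_mem w hw

theorem splitC_mem {c : LieSeries g} (hc : c ∈ S) : splitC P c ∈ S := by
  rw [splitC_eq]
  exact S.add_mem hc (h.bch_mem c hc)

theorem C_eq_splitC {u w : LieSeries g} (hu : u ∈ Sm) (hw : w ∈ Sp) :
    BHL.C (filtration K) u w = splitC P (u + w) := by
  rw [splitC, h.map_add u hu w hw, h.compl_map_add hu hw]

theorem mapsTo_C : Set.MapsTo (fun x : LieSeries g × LieSeries g => BHL.C (filtration K) x.1 x.2)
    ((Sm : Set (LieSeries g)) ×ˢ (Sp : Set _)) S := fun x hx => by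
  dsimp only
  rw [h.C_eq_splitC hx.1 hx.2]
  exact h.splitC_mem (h.add_mem _ hx.1 _ hx.2)

variable [CharZero K]

theorem chi_mem {a : LieSeries g} (ha : a ∈ S) : chi (filtration K) P a ∈ S := by
  refine h.lim_mem _ _ (isFiltLim_chi h.isFiltered (h.le ha)) fun n => ?_
  induction n with
  | zero => exact ha
  | succ n ih => exact S.sub_mem ha (h.bch_mem _ ih)

theorem chi_splitC {c : LieSeries g} (hc : c ∈ S) : chi (filtration K) P (splitC P c) = c :=
  splitC_injOn h.isFiltered
    (LieSeries.chi_mem h.isFiltered (h.le (h.splitC_mem hc))) (h.le hc)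
    (splitC_chi h.isFiltered (h.le (h.splitC_mem hc)))

/-- `splitC P` is a two-sided inverse on `S`; `S` is stable under it by stability under `BCH`, and
stable under `χ` because it is also closed. -/
theorem bijOn_chi : Set.BijOn (chi (filtration K) P) S S :=
  Set.InvOn.bijOn (f' := splitC P) ⟨fun _ ha => splitC_chi h.isFiltered (h.le ha),
    fun _ hc => h.chi_splitC hc⟩ (fun _ ha => h.chi_mem ha) fun _ hc => h.splitC_mem hc

theorem mapsTo_D : Set.MapsTo (D (filtration K) P) S ((Sm : Set (LieSeries g)) ×ˢ (Sp : Set _)) :=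
  fun _ ha => ⟨h.map_mem _ (h.chi_mem ha), h.compl_mem _ (h.chi_mem ha)⟩

theorem invOn_D : Set.InvOn (D (filtration K) P)
    (fun x : LieSeries g × LieSeries g => BHL.C (filtration K) x.1 x.2)
    ((Sm : Set (LieSeries g)) ×ˢ (Sp : Set _)) S := by
  refine ⟨fun x hx => ?_, fun a ha => splitC_chi h.isFiltered (h.le ha)⟩
  dsimp only
  rw [h.C_eq_splitC hx.1 hx.2, D, h.chi_splitC (h.add_mem _ hx.1 _ hx.2),
    h.map_add _ hx.1 _ hx.2, h.compl_map_add hx.1 hx.2]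

theorem bijOn_C : Set.BijOn (fun x : LieSeries g × LieSeries g => BHL.C (filtration K) x.1 x.2)
    ((Sm : Set (LieSeries g)) ×ˢ (Sp : Set _)) S :=
  h.invOn_D.bijOn h.mapsTo_C h.mapsTo_D

theorem bijOn_D : Set.BijOn (D (filtration K) P) S ((Sm : Set (LieSeries g)) ×ˢ (Sp : Set _)) :=
  h.invOn_D.symm.bijOn h.mapsTo_D h.mapsTo_C

theorem exp_D {a : LieSeries g} (ha : a ∈ S) :
    LieSeries.exp K (D (filtration K) P a).1 * LieSeries.exp K (D (filtration K) P a).2 =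
      LieSeries.exp K a := by
  have hD := h.mapsTo_D ha
  rw [← exp_C (h.le (h.left_le hD.1)) (h.le (h.right_le hD.2))]
  exact congrArg (LieSeries.exp K) (h.invOn_D.2 ha)

/-- The uniformization map `D_P ∘ C` is the unique uniformization bijection. -/
theorem isUniqueUniformization (h' : IsSplitting (compl P) S Sp Sm) :
    IsUniqueUniformization K Sp Sm
      (fun a => D (filtration K) P (BHL.C (filtration K) a.1 a.2)) := by
  have hexp : ∀ a ∈ (Sp : Set (LieSeries g)) ×ˢ (Sm : Set (LieSeries g)),
      LieSeries.exp K a.1 * LieSeries.exp K a.2 =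
        LieSeries.exp K (BHL.C (filtration K) a.1 a.2) := fun a ha =>
    (exp_C (h.le (h.right_le ha.1)) (h.le (h.left_le ha.2))).symm
  refine ⟨⟨h.bijOn_D.comp h'.bijOn_C, fun a ha => ?_⟩, fun Φ hΦ a ha => ?_⟩
  · rw [hexp a ha, h.exp_D (h'.mapsTo_C ha)]
  · have hm := hΦ.1.mapsTo ha
    have h1 := hΦ.2 a ha
    have hC := h.mapsTo_C hm
    rw [hexp a ha, ← exp_C (h.le (h.left_le hm.1)) (h.le (h.right_le hm.2))] at h1
    -- Any competitor satisfies `exp(C(Φ a)) = exp(C(a))`, hence `C(Φ a) = C(a)`, and `D_P` recovers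
    -- `Φ a`.
    have h2 := exp_injOn (h.le (h'.mapsTo_C ha)) (h.le hC) h1
    dsimp only at h2 ⊢
    rw [h2]
    exact (h.invOn_D.1 hm).symm

/-- The inverse of `χ` is `splitC P`, whose value at `u + w` is `C(u, w)`. Applied to `P̃` it yields
the formula with `χ̃⁻¹`. -/
theorem invFunOn_chi {u w : LieSeries g} (hu : u ∈ Sm) (hw : w ∈ Sp) :
    Function.invFunOn (chi (filtration K) P) S (u + w) = BHL.C (filtration K) u w := by
  have hc := h.add_mem u hu w hw
  have hex : ∃ a ∈ (S : Set (LieSeries g)), chi (filtration K) P a = u + w :=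
    ⟨_, h.splitC_mem hc, h.chi_splitC hc⟩
  refine h.bijOn_chi.injOn (Function.invFunOn_mem hex) (h.mapsTo_C (x := (u, w)) ⟨hu, hw⟩) ?_
  rw [Function.invFunOn_eq hex, h.C_eq_splitC hu hw, h.chi_splitC hc]

end IsSplitting

end Splitting

/-! ### The splittings of `g[[s,t]]₁` and of `s g⁻[[s,t]] ⊕ t g⁺[[s,t]]` -/

section Idempotent

variable {K : Type*} [Field K] {g : Type*} [LieRing g] [LieAlgebra K g] {P₀ : g →ₗ[K] g}

theorem mapCoeff_apply (P₀ : g →ₗ[K] g) (x : LieSeries g) (d : Fin 2 →₀ ℕ) :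
    mapCoeff P₀ x d = P₀ (x d) := rfl

theorem compl_mapCoeff (P₀ : g →ₗ[K] g) : compl (mapCoeff P₀) = mapCoeff (compl P₀) := rfl

theorem compl_idem (hP : P₀ ∘ₗ P₀ = P₀) : compl P₀ ∘ₗ compl P₀ = compl P₀ := by
  have h : ∀ a, P₀ (P₀ a) = P₀ a := fun a => congrArg (fun f => f a) hP
  ext a
  simp [compl, h]

theorem mapCoeff_idem (hP : P₀ ∘ₗ P₀ = P₀) (x : LieSeries g) :
    mapCoeff P₀ (mapCoeff P₀ x) = mapCoeff P₀ x := by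
  funext d
  exact congrArg (fun f => f (x d)) hP

theorem isFiltered_mapCoeff (P₀ : g →ₗ[K] g) : IsFiltered (mapCoeff P₀) := fun n x hx d hd => by
  rw [mapCoeff_apply, hx d hd, map_zero]

theorem filtration_lim_mem {n : ℕ} {u : ℕ → LieSeries g} {l : LieSeries g}
    (hl : IsFiltLim (filtration K) u l) (hu : ∀ k, u k ∈ filtration K n) : l ∈ filtration K n := by
  obtain ⟨M, hM⟩ := hl n
  have := Submodule.sub_mem _ (hu M) (hM M le_rfl)
  rwa [sub_sub_cancel] at this

theorem isSplitting_filtration [CharZero K] (hP : P₀ ∘ₗ P₀ = P₀) :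
    IsSplitting (mapCoeff P₀) (filtration K 1) ((filtration K 1).map (mapCoeff P₀))
      ((filtration K 1).map (compl (mapCoeff P₀))) where
  isFiltered := isFiltered_mapCoeff P₀
  le := le_rfl
  add_mem := by
    rintro _ ⟨u, hu, rfl⟩ _ ⟨w, hw, rfl⟩
    exact Submodule.add_mem _ (isFiltered_mapCoeff P₀ 1 u hu)
      ((isFiltered_mapCoeff P₀).compl 1 w hw)
  map_add := by
    rintro _ ⟨u, hu, rfl⟩ _ ⟨w, hw, rfl⟩
    rw [compl_apply, map_add, map_sub, mapCoeff_idem hP, mapCoeff_idem hP, sub_self, add_zero]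
  map_mem c hc := Submodule.mem_map_of_mem hc
  compl_mem c hc := Submodule.mem_map_of_mem hc
  bch_mem c hc := splitBCH_mem (isFiltered_mapCoeff P₀) hc
  lim_mem u l hl hu := filtration_lim_mem hl hu

theorem mem_map_mulVar {W : Submodule K g} {i : Fin 2} {x : LieSeries g} :
    x ∈ (coeffsIn W).map (mulVar K i) ↔ (∀ d, x d ∈ W) ∧ ∀ d : Fin 2 →₀ ℕ, d i = 0 → x d = 0 := by
  constructor
  · rintro ⟨y, hy, rfl⟩
    have happ : ∀ d, mulVar K i y d = if 1 ≤ d i then y (d - Finsupp.single i 1) else 0 :=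
      fun d => rfl
    refine ⟨fun d => ?_, fun d hd => ?_⟩
    · rw [happ]
      split_ifs
      · exact hy _
      · exact W.zero_mem
    · rw [happ, if_neg (by omega)]
  · rintro ⟨h1, h2⟩
    refine ⟨fun d => x (d + Finsupp.single i 1), fun d => h1 _, ?_⟩
    funext d
    change (if 1 ≤ d i then x (d - Finsupp.single i 1 + Finsupp.single i 1) else 0) = x d
    split_ifs with h
    · rw [tsub_add_cancel_of_le (Finsupp.single_le_iff.2 h)]
    · exact (h2 d (by omega)).symm

theorem mem_range_iff_of_idem (hP : P₀ ∘ₗ P₀ = P₀) {a : g} :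
    a ∈ LinearMap.range P₀ ↔ P₀ a = a :=
  ⟨by rintro ⟨b, rfl⟩; exact congrArg (fun f => f b) hP, fun h => ⟨a, h⟩⟩

theorem mem_sMinus (hP : P₀ ∘ₗ P₀ = P₀) {x : LieSeries g} :
    x ∈ sMinus P₀ ↔ (∀ d, P₀ (x d) = x d) ∧ ∀ d : Fin 2 →₀ ℕ, d 0 = 0 → x d = 0 := by
  rw [sMinus, mem_map_mulVar]
  simp only [mem_range_iff_of_idem hP]

theorem mem_tPlus (hP : P₀ ∘ₗ P₀ = P₀) {x : LieSeries g} :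
    x ∈ tPlus P₀ ↔ (∀ d, P₀ (x d) = 0) ∧ ∀ d : Fin 2 →₀ ℕ, d 1 = 0 → x d = 0 := by
  rw [tPlus, mem_map_mulVar]
  simp only [mem_range_iff_of_idem (compl_idem hP)]
  refine and_congr_left fun _ => forall_congr' fun d => ?_
  change x d - P₀ (x d) = x d ↔ _
  rw [sub_eq_self]

theorem mem_filtration_one {x : LieSeries g} : x ∈ filtration K 1 ↔ x 0 = 0 := by
  refine ⟨fun h => h 0 (by simp), fun h d hd => ?_⟩
  have : d = 0 := (Finsupp.degree_eq_zero_iff d).1 (by omega)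
  rw [this, h]

/-- Only terms free of `s` or free of `t` are constrained, so every series divisible by `st` belongs
to the sum. At `d = 0` both conditions together force the constant term to vanish. -/
theorem mem_sMinus_sup_tPlus (hP : P₀ ∘ₗ P₀ = P₀) {x : LieSeries g} :
    x ∈ sMinus P₀ ⊔ tPlus P₀ ↔ ∀ d : Fin 2 →₀ ℕ,
      (d 0 = 0 → P₀ (x d) = 0) ∧ (d 1 = 0 → P₀ (x d) = x d) := by
  have hP' : ∀ a, P₀ (P₀ a) = P₀ a := fun a => congrArg (fun f => f a) hP
  constructor
  · intro hx d
    obtain ⟨u, hu, w, hw, rfl⟩ := Submodule.mem_sup.1 hx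
    rw [mem_sMinus hP] at hu
    rw [mem_tPlus hP] at hw
    rw [add_apply, map_add, hu.1, hw.1]
    exact ⟨fun h => by rw [hu.2 d h, zero_add], fun h => by rw [hw.2 d h]⟩
  · intro hx
    refine Submodule.mem_sup.2 ⟨mapCoeff P₀ x, (mem_sMinus hP).2 ⟨fun d => hP' _,
      fun d hd => (hx d).1 hd⟩, compl (mapCoeff P₀) x, (mem_tPlus hP).2 ⟨fun d => ?_,
      fun d hd => ?_⟩, ?_⟩
    · rw [compl_apply, sub_apply, mapCoeff_apply, map_sub, hP', sub_self]
    · rw [compl_apply, sub_apply, mapCoeff_apply, (hx d).2 hd, sub_self]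
    · rw [compl_apply, add_sub_cancel]

theorem sMinus_sup_tPlus_le (hP : P₀ ∘ₗ P₀ = P₀) : sMinus P₀ ⊔ tPlus P₀ ≤ filtration K 1 :=
  fun x hx => by
    have h := (mem_sMinus_sup_tPlus hP).1 hx 0
    rw [mem_filtration_one, ← h.2 rfl, h.1 rfl]

theorem mapCoeff_mem_sMinus (hP : P₀ ∘ₗ P₀ = P₀) {x : LieSeries g}
    (hx : x ∈ sMinus P₀ ⊔ tPlus P₀) : mapCoeff P₀ x ∈ sMinus P₀ :=
  (mem_sMinus hP).2 ⟨fun d => congrArg (fun f => f (x d)) hP,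
    fun d hd => ((mem_sMinus_sup_tPlus hP).1 hx d).1 hd⟩

theorem compl_mapCoeff_mem_tPlus (hP : P₀ ∘ₗ P₀ = P₀) {x : LieSeries g}
    (hx : x ∈ sMinus P₀ ⊔ tPlus P₀) : compl (mapCoeff P₀) x ∈ tPlus P₀ := by
  have hP' : ∀ a, P₀ (P₀ a) = P₀ a := fun a => congrArg (fun f => f a) hP
  refine (mem_tPlus hP).2 ⟨fun d => ?_, fun d hd => ?_⟩
  · rw [compl_apply, sub_apply, mapCoeff_apply, map_sub, hP', sub_self]
  · rw [compl_apply, sub_apply, mapCoeff_apply, ((mem_sMinus_sup_tPlus hP).1 hx d).2 hd, sub_self]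

theorem sMinus_sup_tPlus_lim_mem (hP : P₀ ∘ₗ P₀ = P₀) {u : ℕ → LieSeries g} {l : LieSeries g}
    (hl : IsFiltLim (filtration K) u l) (hu : ∀ n, u n ∈ sMinus P₀ ⊔ tPlus P₀) :
    l ∈ sMinus P₀ ⊔ tPlus P₀ := by
  refine (mem_sMinus_sup_tPlus hP).2 fun d => ?_
  obtain ⟨M, hM⟩ := hl (d.degree + 1)
  have h : u M d = l d := sub_eq_zero.1 (hM M le_rfl d (by omega))
  rw [← h]
  exact (mem_sMinus_sup_tPlus hP).1 (hu M) d

variable [CharZero K]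

/-- One argument vanishes at `s = 0` and the other at `t = 0`, so `BCH` in either order is divisible
by `st`. Both orders are needed, for `χ` and for `χ̃`. -/
theorem BCH_mem_of_sMinus_tPlus (hP : P₀ ∘ₗ P₀ = P₀) {u w : LieSeries g} (hu : u ∈ sMinus P₀)
    (hw : w ∈ tPlus P₀) : BCH (filtration K) u w ∈ sMinus P₀ ⊔ tPlus P₀ ∧
      BCH (filtration K) w u ∈ sMinus P₀ ⊔ tPlus P₀ := by
  have hu1 : u ∈ filtration K 1 := sMinus_sup_tPlus_le hP (Submodule.mem_sup_left hu)
  have hw1 : w ∈ filtration K 1 := sMinus_sup_tPlus_le hP (Submodule.mem_sup_right hw)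
  have hu0 := ((mem_sMinus hP).1 hu).2
  have hw0 := ((mem_tPlus hP).1 hw).2
  constructor
  · refine (mem_sMinus_sup_tPlus hP).2 fun d => ⟨fun hd => ?_, fun hd => ?_⟩
    · rw [BCH_apply_eq_zero_of_left hu1 hw1 hu0 hd, map_zero]
    · rw [BCH_apply_eq_zero_of_right hu1 hw1 hw0 hd, map_zero]
  · refine (mem_sMinus_sup_tPlus hP).2 fun d => ⟨fun hd => ?_, fun hd => ?_⟩
    · rw [BCH_apply_eq_zero_of_right hw1 hu1 hu0 hd, map_zero]
    · rw [BCH_apply_eq_zero_of_left hw1 hu1 hw0 hd, map_zero]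

theorem isSplitting_sup (hP : P₀ ∘ₗ P₀ = P₀) :
    IsSplitting (mapCoeff P₀) (sMinus P₀ ⊔ tPlus P₀) (sMinus P₀) (tPlus P₀) where
  isFiltered := isFiltered_mapCoeff P₀
  le := sMinus_sup_tPlus_le hP
  add_mem u hu w hw := Submodule.add_mem_sup hu hw
  map_add u hu w hw := by
    funext d
    rw [mapCoeff_apply, add_apply, map_add, ((mem_sMinus hP).1 hu).1, ((mem_tPlus hP).1 hw).1,
      add_zero]
  map_mem c hc := mapCoeff_mem_sMinus hP hc
  compl_mem c hc := compl_mapCoeff_mem_tPlus hP hc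
  bch_mem c hc :=
    (BCH_mem_of_sMinus_tPlus hP (mapCoeff_mem_sMinus hP hc) (compl_mapCoeff_mem_tPlus hP hc)).1
  lim_mem u l hl hu := sMinus_sup_tPlus_lim_mem hP hl hu

theorem isSplitting_sup_compl (hP : P₀ ∘ₗ P₀ = P₀) :
    IsSplitting (compl (mapCoeff P₀)) (sMinus P₀ ⊔ tPlus P₀) (tPlus P₀) (sMinus P₀) where
  isFiltered := (isFiltered_mapCoeff P₀).compl
  le := sMinus_sup_tPlus_le hP
  add_mem u hu w hw := by
    rw [add_comm]
    exact Submodule.add_mem_sup hw hu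
  map_add u hu w hw := by
    rw [compl_apply, add_comm u w, (isSplitting_sup hP).map_add w hw u hu, add_sub_cancel_left]
  map_mem c hc := compl_mapCoeff_mem_tPlus hP hc
  compl_mem c hc := by
    rw [compl_compl]
    exact mapCoeff_mem_sMinus hP hc
  bch_mem c hc := by
    rw [compl_compl]
    exact (BCH_mem_of_sMinus_tPlus hP (mapCoeff_mem_sMinus hP hc)
      (compl_mapCoeff_mem_tPlus hP hc)).2
  lim_mem u l hl hu := sMinus_sup_tPlus_lim_mem hP hl hu

theorem isSplitting_filtration_compl (hP : P₀ ∘ₗ P₀ = P₀) :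
    IsSplitting (compl (mapCoeff P₀)) (filtration K 1)
      ((filtration K 1).map (compl (mapCoeff P₀))) ((filtration K 1).map (mapCoeff P₀)) := by
  have h := isSplitting_filtration (compl_idem hP)
  rwa [← compl_mapCoeff, compl_compl] at h

end Idempotent

end LieSeries

end

end BHL

/-! ### The main theorem -/

open BHL BHL.LieSeries in
theorem mainTheorem5 {K : Type*} [Field K] [CharZero K] {g : Type*} [LieRing g] [LieAlgebra K g]
    (P₀ : g →ₗ[K] g) (hP : P₀ ∘ₗ P₀ = P₀) :
    let F : ℕ → Submodule K (LieSeries g) := filtration K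
    let P : LieSeries g →ₗ[K] LieSeries g := mapCoeff P₀
    let Q : LieSeries g →ₗ[K] LieSeries g := compl P
    let Am : Submodule K (LieSeries g) := (F 1).map P
    let Ap : Submodule K (LieSeries g) := (F 1).map Q
    let Um : Submodule K (LieSeries g) := sMinus P₀
    let Up : Submodule K (LieSeries g) := tPlus P₀
    let V : Submodule K (LieSeries g) := Um ⊔ Up
    let Cmap : LieSeries g × LieSeries g → LieSeries g := fun x => BHL.C F x.1 x.2
    -- the series `C` and the recursions `χ`, `χ̃` converge on the degree-one part,
    -- and `C` is the Baker--Campbell--Hausdorff map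
    (∀ x ∈ F 1, ∀ y ∈ F 1, IsFiltLim F (hausdorffSum K x y) (BHL.C F x y) ∧ BHL.C F x y ∈ F 1 ∧
      LieSeries.exp K (BHL.C F x y) = LieSeries.exp K x * LieSeries.exp K y) ∧
    (∀ a ∈ F 1, IsFiltLim F (chiSeq F P a) (chi F P a) ∧
      IsFiltLim F (chiSeq F Q a) (chi F Q a)) ∧
    Set.BijOn (chi F P) (F 1) (F 1) ∧ Set.BijOn (chi F Q) (F 1) (F 1) ∧
    -- the spaces `s g⁻[[s,t]]`, `t g⁺[[s,t]]` sit in those of the idempotent theorem,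
    -- and their sum is direct
    Um ≤ Am ∧ Up ≤ Ap ∧ V ≤ F 1 ∧ Disjoint Um Up ∧
    -- factorization: `C_-` is bijective, and so is its restriction
    Set.BijOn Cmap ((Am : Set (LieSeries g)) ×ˢ (Ap : Set (LieSeries g))) (F 1) ∧
    Set.BijOn Cmap ((Um : Set (LieSeries g)) ×ˢ (Up : Set (LieSeries g))) V ∧
    -- the inverses of both are given by `D_P`
    Set.InvOn (D F P) Cmap ((Am : Set (LieSeries g)) ×ˢ (Ap : Set (LieSeries g))) (F 1) ∧
    Set.MapsTo (D F P) (F 1) ((Am : Set (LieSeries g)) ×ˢ (Ap : Set (LieSeries g))) ∧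
    Set.InvOn (D F P) Cmap ((Um : Set (LieSeries g)) ×ˢ (Up : Set (LieSeries g))) V ∧
    Set.MapsTo (D F P) V ((Um : Set (LieSeries g)) ×ˢ (Up : Set (LieSeries g))) ∧
    -- `χ` and `χ̃` restrict to bijections of `V`
    Set.BijOn (chi F P) V V ∧ Set.BijOn (chi F Q) V V ∧
    -- uniformization: `Ψ` is the map of the idempotent theorem, `Ψ₀` that on formal exponentials
    ∃ Ψ Ψ₀ : LieSeries g × LieSeries g → LieSeries g × LieSeries g,
      IsUniqueUniformization K Ap Am Ψ ∧
      IsUniqueUniformization K Up Um Ψ₀ ∧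
      Set.EqOn Ψ₀ Ψ ((Up : Set (LieSeries g)) ×ˢ (Um : Set (LieSeries g))) ∧
      (∀ a ∈ (Ap : Set (LieSeries g)) ×ˢ (Am : Set (LieSeries g)),
        Ψ a = (P (chi F P (BHL.C F a.1 a.2)), Q (chi F P (BHL.C F a.1 a.2))) ∧
        Ψ a = (P (chi F P (Function.invFunOn (chi F Q) (F 1) (a.1 + a.2))),
          Q (chi F P (Function.invFunOn (chi F Q) (F 1) (a.1 + a.2))))) ∧
      (∀ a ∈ (Up : Set (LieSeries g)) ×ˢ (Um : Set (LieSeries g)),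
        Ψ₀ a = (P (chi F P (BHL.C F a.1 a.2)), Q (chi F P (BHL.C F a.1 a.2))) ∧
        Ψ₀ a = (P (chi F P (Function.invFunOn (chi F Q) V (a.1 + a.2))),
          Q (chi F P (Function.invFunOn (chi F Q) V (a.1 + a.2))))) := by
  intro F P Q Am Ap Um Up V Cmap
  have h1 : IsSplitting P (F 1) Am Ap := isSplitting_filtration hP
  have h1' : IsSplitting Q (F 1) Ap Am := isSplitting_filtration_compl hP
  have h2 : IsSplitting P V Um Up := isSplitting_sup hP
  have h2' : IsSplitting Q V Up Um := isSplitting_sup_compl hP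
  have hUm : Um ≤ Am := fun u hu =>
    ⟨u, h2.le (h2.left_le hu), by simpa using h2.map_add u hu 0 (Submodule.zero_mem _)⟩
  have hUp : Up ≤ Ap := fun u hu =>
    ⟨u, h2.le (h2.right_le hu), by simpa using h2'.map_add u hu 0 (Submodule.zero_mem _)⟩
  refine ⟨fun x hx y hy => ⟨isFiltLim_C hx hy, C_mem hx hy, exp_C hx hy⟩,
    fun a ha => ⟨isFiltLim_chi h1.isFiltered ha, isFiltLim_chi h1'.isFiltered ha⟩,
    h1.bijOn_chi, h1'.bijOn_chi, hUm, hUp, h2.le, ?_, h1.bijOn_C, h2.bijOn_C, h1.invOn_D,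
    h1.mapsTo_D, h2.invOn_D, h2.mapsTo_D, h2.bijOn_chi, h2'.bijOn_chi,
    -- `Ψ` and `Ψ₀` are the same function `D_P ∘ C`, considered on two domains, so the restriction
    -- statement is trivial.
    fun a => D F P (BHL.C F a.1 a.2), fun a => D F P (BHL.C F a.1 a.2),
    h1.isUniqueUniformization h1', h2.isUniqueUniformization h2', fun _ _ => rfl,
    fun a ha => ⟨rfl, ?_⟩, fun a ha => ⟨rfl, ?_⟩⟩
  · rw [Submodule.disjoint_def]
    intro x hx hx'
    have e1 : P x = x := by simpa using h2.map_add x hx 0 (Submodule.zero_mem _)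
    have e2 : P x = 0 := by simpa using h2.map_add 0 (Submodule.zero_mem _) x hx'
    rw [← e1, e2]
  · rw [h1'.invFunOn_chi ha.1 ha.2]
    rfl
  · rw [h2'.invFunOn_chi ha.1 ha.2]
    rfl
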